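/- All graphs are finite, simple and undirected. The average degree of an $n$-vertex graph $G$ ($n\ge 1$) is $d(G)=2|E(G)|/n$. A graph $G$ contains a $K_t$-minor if some sequence of vertex deletions, edge deletions and edge contractions turns $G$ into the complete graph $K_t$. Let $g(t)$ be the minimum $D$ such that every graph $G$ with $d(G)\ge D$ contains a $K_t$-minor. \textbf{Theorem.} For every $\varepsilon>0$ there is an integer $t(\varepsilon)$ such that for every fixed $t\ge t(\varepsilon)$ there is an $O(n)$-time algorithm that, given an $n$-vertex graph $G$ with $d(G)\ge(2+\varepsilon)g(t)$, finds a $K_t$-minor in $G$, that is, outputs a sequence of vertex deletions, edge deletions and edge contractions that turns $G$ into $K_t$. Here the vertices of $G$ are $0,\dots,n-1$, the input consists of $n$, $|E(G)|$ and an array that lists the edges of $G$ in arbitrary order, and time is measured on a random access machine with words of $O(\log n)$ bits, with memory that is initially $0$ outside the input, at unit cost per word operation and memory access. The program, the constant in $O(n)$ and the constant in the word length depend only on $\varepsilon$ and $t$; in particular the time bound does not depend on $|E(G)|$. -/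

import Mathlib

/-! ### Graph minors through deletions and contractions -/

/-- A graph whose vertices are the elements of a finite set `verts` of labels in `V`, and whose
edges are the edges of `graph` with both ends in `verts`. Edges of `graph` at other labels are
ignored. -/
structure LabelledGraph (V : Type*) where
  verts : Finset V
  graph : SimpleGraph V

/-- The three minor operations. `contract u v` contracts the edge `uv`; the vertex that results
keeps the label `u`. -/
inductive MinorOp (V : Type*) where
  | deleteVertex (v : V)
  | deleteEdge (u v : V)
  | contract (u v : V)

/-- The vertex, or the edge, that the operation refers to is present in the graph. -/
def MinorOp.Legal {V : Type*} (X : LabelledGraph V) : MinorOp V → Prop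
  | .deleteVertex v => v ∈ X.verts
  | .deleteEdge u v => u ∈ X.verts ∧ v ∈ X.verts ∧ X.graph.Adj u v
  | .contract u v => u ∈ X.verts ∧ v ∈ X.verts ∧ X.graph.Adj u v

/-- The result of a minor operation. Contraction yields a simple graph: loops vanish and parallel
edges become one edge. -/
def MinorOp.apply {V : Type*} [DecidableEq V] (X : LabelledGraph V) : MinorOp V → LabelledGraph V
  | .deleteVertex v => ⟨X.verts.erase v, X.graph⟩
  | .deleteEdge u v => ⟨X.verts, X.graph.deleteEdges {s(u, v)}⟩
  | .contract u v =>
      ⟨X.verts.erase v, X.graph ⊔ SimpleGraph.fromRel (fun x y => x = u ∧ X.graph.Adj v y)⟩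

/-- The operations of the list, performed in order from `X`, are all legal and turn `X` into a
complete graph on `t` vertices. -/
def ProducesClique {V : Type*} [DecidableEq V] (t : ℕ) : LabelledGraph V → List (MinorOp V) → Prop
  | X, [] => X.graph.IsNClique t X.verts
  | X, op :: ops => op.Legal X ∧ ProducesClique t (op.apply X) ops

/-- The operations turn the graph `G` into a complete graph on `t` vertices. -/
def IsCliqueMinorOf {n : ℕ} (G : SimpleGraph (Fin n)) (t : ℕ) (ops : List (MinorOp (Fin n))) :
    Prop :=
  ProducesClique t ⟨Finset.univ, G⟩ ops

/-- `G` contains a `K_t`-minor. -/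
def HasCliqueMinor {n : ℕ} (G : SimpleGraph (Fin n)) (t : ℕ) : Prop :=
  ∃ ops : List (MinorOp (Fin n)), IsCliqueMinorOf G t ops

/-- The average degree `2|E(G)| / |V(G)|`. -/
noncomputable def avgDegree {n : ℕ} (G : SimpleGraph (Fin n)) : ℝ :=
  2 * (G.edgeSet.ncard : ℝ) / n

/-- `g(t)`, the least `D` such that every (finite, non-empty) graph of average degree at least `D`
contains a `K_t`-minor. For `t ≥ 3` the infimum is attained. -/
noncomputable def minorThreshold (t : ℕ) : ℝ :=
  sInf {D : ℝ | ∀ (n : ℕ) (G : SimpleGraph (Fin n)), 0 < n → D ≤ avgDegree G → HasCliqueMinor G t}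

/-! ### A word RAM with structured programs

A memory consists of registers `reg r` and of arrays `mem b`, each cell of which holds one word.
A program mentions only finitely many registers and arrays. Control flow is structured: `while`
and `if` in place of jumps. -/

structure RamState where
  reg : ℕ → ℕ
  mem : ℕ → ℕ → ℕ

/-- Word operations: addition, truncated subtraction, multiplication and comparisons (with value
`1` for true and `0` for false). -/
inductive RamOp where
  | add | sub | mul | lt | eq

def RamOp.eval : RamOp → ℕ → ℕ → ℕ
  | .add, a, b => a + b
  | .sub, a, b => a - b
  | .mul, a, b => a * b
  | .lt, a, b => if a < b then 1 else 0
  | .eq, a, b => if a = b then 1 else 0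

/-- `load b e` reads the cell of the array `b` whose address is the value of `e`. -/
inductive RamExpr where
  | const (c : ℕ)
  | reg (r : ℕ)
  | load (b : ℕ) (addr : RamExpr)
  | bin (op : RamOp) (e₁ e₂ : RamExpr)

def RamExpr.eval (s : RamState) : RamExpr → ℕ
  | .const c => c
  | .reg r => s.reg r
  | .load b addr => s.mem b (addr.eval s)
  | .bin op e₁ e₂ => op.eval (e₁.eval s) (e₂.eval s)

/-- The number of steps that the evaluation of an expression takes: one for each constant,
register access, memory access and word operation. -/
def RamExpr.cost : RamExpr → ℕ
  | .const _ => 1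
  | .reg _ => 1
  | .load _ addr => addr.cost + 1
  | .bin _ e₁ e₂ => e₁.cost + e₂.cost + 1

/-- No overflow: all values that occur in the evaluation fit into a machine word, that is, they
are smaller than `W`. -/
def RamExpr.Fits (W : ℕ) (s : RamState) : RamExpr → Prop
  | .const c => c < W
  | .reg r => s.reg r < W
  | .load b addr => addr.Fits W s ∧ s.mem b (addr.eval s) < W
  | .bin op e₁ e₂ => e₁.Fits W s ∧ e₂.Fits W s ∧ op.eval (e₁.eval s) (e₂.eval s) < W

/-- Programs. `set r e` writes to a register, `store b addr e` to the array `b`; a condition holds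
if its value is not `0`. -/
inductive RamProg where
  | skip
  | set (r : ℕ) (e : RamExpr)
  | store (b : ℕ) (addr e : RamExpr)
  | seq (p q : RamProg)
  | ite (c : RamExpr) (p q : RamProg)
  | loop (c : RamExpr) (p : RamProg)

/-- `RamExec W p s k s'`: on a machine whose words hold the numbers below `W`, the program `p`,
started in the state `s`, halts after exactly `k` steps in the state `s'`, without any overflow. -/
inductive RamExec (W : ℕ) : RamProg → RamState → ℕ → RamState → Prop
  | skip (s : RamState) : RamExec W .skip s 1 s
  | set (s : RamState) (r : ℕ) (e : RamExpr) (he : e.Fits W s) :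
      RamExec W (.set r e) s (e.cost + 1) { s with reg := Function.update s.reg r (e.eval s) }
  | store (s : RamState) (b : ℕ) (addr e : RamExpr) (ha : addr.Fits W s) (he : e.Fits W s) :
      RamExec W (.store b addr e) s (addr.cost + e.cost + 1)
        { s with
          mem := Function.update s.mem b (Function.update (s.mem b) (addr.eval s) (e.eval s)) }
  | seq (p q : RamProg) (s s' s'' : RamState) (k l : ℕ)
      (hp : RamExec W p s k s') (hq : RamExec W q s' l s'') :
      RamExec W (.seq p q) s (k + l) s''
  | iteTrue (c : RamExpr) (p q : RamProg) (s s' : RamState) (k : ℕ) (hf : c.Fits W s)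
      (hc : c.eval s ≠ 0) (hp : RamExec W p s k s') :
      RamExec W (.ite c p q) s (c.cost + 1 + k) s'
  | iteFalse (c : RamExpr) (p q : RamProg) (s s' : RamState) (k : ℕ) (hf : c.Fits W s)
      (hc : c.eval s = 0) (hq : RamExec W q s k s') :
      RamExec W (.ite c p q) s (c.cost + 1 + k) s'
  | loopFalse (c : RamExpr) (p : RamProg) (s : RamState) (hf : c.Fits W s) (hc : c.eval s = 0) :
      RamExec W (.loop c p) s (c.cost + 1) s
  | loopTrue (c : RamExpr) (p : RamProg) (s s' s'' : RamState) (k l : ℕ) (hf : c.Fits W s)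
      (hc : c.eval s ≠ 0) (hp : RamExec W p s k s') (hl : RamExec W (.loop c p) s' l s'') :
      RamExec W (.loop c p) s (c.cost + 1 + k + l) s''

/-! ### Input and output -/

/-- `es` lists the edges of `G`: each edge exactly once, in any order and orientation. -/
def IsEdgeList {n : ℕ} (G : SimpleGraph (Fin n)) (es : List (Fin n × Fin n)) : Prop :=
  (es.map fun e => s(e.1, e.2)).Nodup ∧
    ∀ u v : Fin n, s(u, v) ∈ es.map (fun e => s(e.1, e.2)) ↔ G.Adj u v

/-- The start state for a graph with vertices `0, …, n - 1` and edge list `es`: register `0` holds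
the number of vertices, register `1` the number of edges, and the cells `i` of the arrays `0` and
`1` hold the two ends of the `i`-th edge. All other cells are `0`. -/
def ramInput (n : ℕ) (es : List (Fin n × Fin n)) : RamState where
  reg := fun r => if r = 0 then n else if r = 1 then es.length else 0
  mem := fun b i =>
    if b = 0 then (es.map fun e => (e.1 : ℕ)).getD i 0
    else if b = 1 then (es.map fun e => (e.2 : ℕ)).getD i 0
    else 0

/-- The three words `(code, u, v)` encode the operation; for the deletion of a vertex the third
word is not used. -/
def MinorOp.EncodedBy {n : ℕ} (code u v : ℕ) : MinorOp (Fin n) → Prop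
  | .deleteVertex x => code = 0 ∧ u = x
  | .deleteEdge x y => code = 1 ∧ u = x ∧ v = y
  | .contract x y => code = 2 ∧ u = x ∧ v = y

/-- The output that a final state holds is the sequence `ops`: register `0` holds its length, and
the cells `i` of the arrays `2`, `3`, `4` encode the `i`-th operation. -/
def RamState.Outputs {n : ℕ} (s : RamState) (ops : List (MinorOp (Fin n))) : Prop :=
  s.reg 0 = ops.length ∧
    ∀ (i : ℕ) (hi : i < ops.length), ops[i].EncodedBy (s.mem 2 i) (s.mem 3 i) (s.mem 4 i)

/-- Given a list of the edges of the `n`-vertex graph `G`, the program `p` finds a `K_t`-minor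
within `T` steps on a machine whose words hold the numbers below `W`: it halts, and it outputs a
sequence of deletions and contractions that turns `G` into `K_t`. -/
def FindsCliqueMinor (p : RamProg) (t W T : ℕ) {n : ℕ} (G : SimpleGraph (Fin n)) : Prop :=
  ∀ es : List (Fin n × Fin n), IsEdgeList G es →
    ∃ (k : ℕ) (s : RamState) (ops : List (MinorOp (Fin n))),
      RamExec W p (ramInput n es) k s ∧ k ≤ T ∧ s.Outputs ops ∧ IsCliqueMinorOf G t ops

/-! Put q = ⌊g(t)⌋ + 1. For large t, g(t) ≥ 2/ε + 1, so average degree (2 + ε)g(t) means at least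
(g(t) + 1)n ≥ qn edges. Only the first qn listed edges are read. From then on a graph H inside a
minor X of G is maintained with e(H) ≥ q|X|. Let v be a vertex of degree at most 2q + 1 in H. If a
neighbour u has fewer than q common neighbours with v, contracting uv costs one vertex and at most q
edges, so the invariant survives (`Run.contractVertex`); an isolated v is deleted. Otherwise N(v) is
a non-empty set of at most 2q + 1 vertices that spans minimum degree at least q > g(t), hence
contains a K_t-minor by the definition of g, and the search stops. If no vertex has degree at most
2q + 1, then e(H) ≥ (q + 1)|X| and an edge can be dropped from H (`Run.thinOut`). The factor 2 in
the theorem is the loss from average degree 2q to minimum degree q.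

Every round takes constant time: degrees of treated vertices are bounded, and neighbour lists with
an adjacency matrix allow constant time updates; the matrix is never initialised because memory
starts at 0. A stack holds all candidates for small degree. Stack height, edges, vertices and the
remaining range of a cursor combine to a linear potential that drops in every round
(`exec_mainLoop`).

Once N(v) is found, all other vertices are deleted. What remains has bounded size, so a table of all
labelled graphs on at most 2q + 1 vertices, each with operations chosen beforehand, supplies the
rest of the output (`Run.lookUp`). `ProducesClique.map` transfers these operations to X, whose
additional edges do no harm.

It must also be shown that g(t) is an infimum over a non-empty set. `exists_edges_force_cliqueMinor`
gets this from the same program, read as an existence proof: the neighbourhood it finds is dense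
enough for a K_t-minor by induction, and its centre extends this to K_{t+1}. -/

/-! ### Sequences of minor operations -/

/-- The operations of the list, performed in order from `X`, are all legal and lead to `Y`. -/
def Reaches {V : Type*} [DecidableEq V] :
    LabelledGraph V → List (MinorOp V) → LabelledGraph V → Prop
  | X, [], Y => X = Y
  | X, op :: ops, Y => op.Legal X ∧ Reaches (op.apply X) ops Y

theorem Reaches.append {V : Type*} [DecidableEq V] {ops ops' : List (MinorOp V)} :
    ∀ {X Y Z : LabelledGraph V}, Reaches X ops Y → Reaches Y ops' Z →
      Reaches X (ops ++ ops') Z := by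
  induction ops with
  | nil => rintro X Y Z rfl h; exact h
  | cons op ops ih => rintro X Y Z ⟨h₁, h₂⟩ h; exact ⟨h₁, ih h₂ h⟩

theorem Reaches.snoc {V : Type*} [DecidableEq V] {ops : List (MinorOp V)} {X Y : LabelledGraph V}
    {op : MinorOp V} (h : Reaches X ops Y) (hop : op.Legal Y) :
    Reaches X (ops ++ [op]) (op.apply Y) :=
  h.append ⟨hop, rfl⟩

theorem Reaches.producesClique {V : Type*} [DecidableEq V] {t : ℕ} {ops ops' : List (MinorOp V)} :
    ∀ {X Y : LabelledGraph V}, Reaches X ops Y → ProducesClique t Y ops' →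
      ProducesClique t X (ops ++ ops') := by
  induction ops with
  | nil => rintro X Y rfl h; exact h
  | cons op ops ih => rintro X Y ⟨h₁, h₂⟩ h; exact ⟨h₁, ih h₂ h⟩

theorem reaches_deleteVertex {V : Type*} [DecidableEq V] (L : List V) :
    ∀ X : LabelledGraph V, L.Nodup → (∀ a ∈ L, a ∈ X.verts) →
      Reaches X (L.map .deleteVertex) ⟨X.verts \ L.toFinset, X.graph⟩ := by
  induction L with
  | nil => intro X _ _; simp [Reaches]
  | cons a L ih =>
    intro X hL h
    rw [List.nodup_cons] at hL
    refine ⟨h a (by simp), ?_⟩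
    have := ih ⟨X.verts.erase a, X.graph⟩ hL.2 fun b hb =>
      Finset.mem_erase.2 ⟨fun hba => hL.1 (hba ▸ hb), h b (by simp [hb])⟩
    have heq : X.verts \ (a :: L).toFinset = X.verts.erase a \ L.toFinset := by
      ext b
      simp
      tauto
    rw [heq]
    exact this

/-- No operation adds a vertex. This yields the lower bound for g. -/
theorem ProducesClique.le_card {V : Type*} [DecidableEq V] {t : ℕ} {ops : List (MinorOp V)} :
    ∀ {X : LabelledGraph V}, ProducesClique t X ops → t ≤ X.verts.card := by
  induction ops with
  | nil => intro X h; exact h.card_eq.ge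
  | cons op ops ih =>
    rintro X ⟨-, h⟩
    refine (ih h).trans (Finset.card_le_card ?_)
    cases op <;> simp [MinorOp.apply, Finset.erase_subset]

/-- Relabelling of an operation. -/
def MinorOp.map {V U : Type*} (φ : V → U) : MinorOp V → MinorOp U
  | .deleteVertex v => .deleteVertex (φ v)
  | .deleteEdge u v => .deleteEdge (φ u) (φ v)
  | .contract u v => .contract (φ u) (φ v)

/-- Operations that turn `X` into a clique do so in every graph `Y` that consists of a copy of a
supergraph of `X` and of a clique `R` that is joined completely to it. -/
theorem ProducesClique.map {V U : Type*} [DecidableEq V] [DecidableEq U] {t : ℕ} (φ : V ↪ U)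
    (R : Finset U) (hR : ∀ r ∈ R, ∀ a, φ a ≠ r) {ops : List (MinorOp V)} :
    ∀ {X : LabelledGraph V} {Y : LabelledGraph U}, Y.verts = X.verts.map φ ∪ R →
      (∀ a ∈ X.verts, ∀ b ∈ X.verts, X.graph.Adj a b → Y.graph.Adj (φ a) (φ b)) →
      (∀ r ∈ R, ∀ a ∈ X.verts, Y.graph.Adj r (φ a)) → Y.graph.IsClique R →
      ProducesClique t X ops → ProducesClique (t + R.card) Y (ops.map (MinorOp.map φ)) := by
  induction ops with
  | nil =>
    intro X Y hv hXY hRY hC h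
    have hdisj : Disjoint (X.verts.map φ) R := by
      rw [Finset.disjoint_left]
      intro x hx hxR
      obtain ⟨a, -, rfl⟩ := Finset.mem_map.1 hx
      exact hR _ hxR a rfl
    refine ⟨?_, ?_⟩
    · rw [hv]
      intro x hx y hy hxy
      have hx : (∃ a ∈ X.verts, φ a = x) ∨ x ∈ R := by simpa using hx
      have hy : (∃ a ∈ X.verts, φ a = y) ∨ y ∈ R := by simpa using hy
      rcases hx with ⟨a, ha, rfl⟩ | hx <;> rcases hy with ⟨b, hb, rfl⟩ | hy
      · exact hXY a ha b hb (h.isClique ha hb fun hab => hxy (hab ▸ rfl))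
      · exact (hRY _ hy _ ha).symm
      · exact hRY _ hx _ hb
      · exact hC hx hy hxy
    · rw [hv, Finset.card_union_of_disjoint hdisj, Finset.card_map, h.card_eq]
  | cons op ops ih =>
    rintro X Y hv hXY hRY hC ⟨hl, h⟩
    have hmem : ∀ a ∈ X.verts, φ a ∈ Y.verts := fun a ha => by
      rw [hv]; exact Finset.mem_union_left _ (Finset.mem_map_of_mem φ ha)
    have herase : ∀ v, Y.verts.erase (φ v) = (X.verts.erase v).map φ ∪ R := by
      intro v
      ext x
      simp only [hv, Finset.mem_erase, Finset.mem_union, Finset.mem_map]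
      constructor
      · rintro ⟨hx, ⟨a, ha, rfl⟩ | hx'⟩
        · exact Or.inl ⟨a, ⟨fun h => hx (h ▸ rfl), ha⟩, rfl⟩
        · exact Or.inr hx'
      · rintro (⟨a, ⟨hav, ha⟩, rfl⟩ | hx)
        · exact ⟨fun h => hav (φ.injective h), Or.inl ⟨a, ha, rfl⟩⟩
        · exact ⟨fun h => hR x hx v h.symm, Or.inr hx⟩
    cases op with
    | deleteVertex v =>
      refine ⟨hmem _ hl, ih (X := MinorOp.apply X (.deleteVertex v))
        (Y := MinorOp.apply Y (.deleteVertex (φ v))) (herase v) ?_ ?_ hC h⟩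
      · exact fun a ha b hb => hXY a (Finset.mem_of_mem_erase ha) b (Finset.mem_of_mem_erase hb)
      · exact fun r hr a ha => hRY r hr a (Finset.mem_of_mem_erase ha)
    | deleteEdge u v =>
      refine ⟨⟨hmem _ hl.1, hmem _ hl.2.1, hXY _ hl.1 _ hl.2.1 hl.2.2⟩, ih
        (X := MinorOp.apply X (.deleteEdge u v)) (Y := MinorOp.apply Y (.deleteEdge (φ u) (φ v)))
        hv ?_ ?_ ?_ h⟩
      · intro a ha b hb hab
        -- By injectivity of `φ`, the copy loses only the image of the deleted edge.
        simp only [MinorOp.apply, SimpleGraph.deleteEdges_adj, Set.mem_singleton_iff,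
          Sym2.eq_iff] at hab ⊢
        simp only [EmbeddingLike.apply_eq_iff_eq]
        exact ⟨hXY a ha b hb hab.1, hab.2⟩
      · intro r hr a ha
        simp only [MinorOp.apply, SimpleGraph.deleteEdges_adj, Set.mem_singleton_iff, Sym2.eq_iff]
        exact ⟨hRY r hr a ha, by
          rintro (⟨h, -⟩ | ⟨h, -⟩) <;> exact hR r hr _ h.symm⟩
      · intro r hr r' hr' hne
        simp only [MinorOp.apply, SimpleGraph.deleteEdges_adj, Set.mem_singleton_iff, Sym2.eq_iff]
        exact ⟨hC hr hr' hne, by rintro (⟨h, -⟩ | ⟨h, -⟩) <;> exact hR r hr _ h.symm⟩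
    | contract u v =>
      refine ⟨⟨hmem _ hl.1, hmem _ hl.2.1, hXY _ hl.1 _ hl.2.1 hl.2.2⟩, ih
        (X := MinorOp.apply X (.contract u v)) (Y := MinorOp.apply Y (.contract (φ u) (φ v)))
        (herase v) ?_ ?_ ?_ h⟩
      · intro a ha b hb hab
        have ha' : a ∈ X.verts := Finset.mem_of_mem_erase ha
        have hb' : b ∈ X.verts := Finset.mem_of_mem_erase hb
        simp only [MinorOp.apply, SimpleGraph.sup_adj, SimpleGraph.fromRel_adj] at hab ⊢
        rcases hab with hab | ⟨hne, ⟨rfl, hvb⟩ | ⟨rfl, hva⟩⟩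
        · exact Or.inl (hXY a ha' b hb' hab)
        · exact Or.inr ⟨φ.injective.ne hne, Or.inl ⟨rfl, hXY v hl.2.1 b hb' hvb⟩⟩
        · exact Or.inr ⟨φ.injective.ne hne, Or.inr ⟨rfl, hXY v hl.2.1 a ha' hva⟩⟩
      · exact fun r hr a ha => Or.inl (hRY r hr a (Finset.mem_of_mem_erase ha))
      · exact fun r hr r' hr' hne => Or.inl (hC hr hr' hne)

/-! ### Dense neighbourhoods and edge counts -/

/-- The vertex `v` of `X` has a non-empty set of neighbours that spans a subgraph `A` of minimum
degree at least `q`. -/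
structure DenseNeighborhood {V : Type*} (q : ℕ) (X : LabelledGraph V) (v : V) {d : ℕ}
    (A : SimpleGraph (Fin d)) (φ : Fin d ↪ V) : Prop where
  center_mem : v ∈ X.verts
  pos : 0 < d
  mem : ∀ i, φ i ∈ X.verts
  adj_center : ∀ i, X.graph.Adj v (φ i)
  adj : ∀ i j, A.Adj i j → X.graph.Adj (φ i) (φ j)
  le_degree : ∀ i, q ≤ (A.neighborSet i).ncard

theorem sum_ncard_neighborSet {n : ℕ} (G : SimpleGraph (Fin n)) :
    ∑ i, (G.neighborSet i).ncard = 2 * G.edgeSet.ncard := by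
  classical
  have := G.sum_degrees_eq_twice_card_edges
  rw [← SimpleGraph.coe_edgeFinset, Set.ncard_coe_finset, ← this]
  refine Finset.sum_congr rfl fun i _ => ?_
  rw [← SimpleGraph.card_neighborFinset_eq_degree, ← Set.ncard_coe_finset,
    SimpleGraph.coe_neighborFinset]

theorem mul_le_two_mul_edges {q n : ℕ} {G : SimpleGraph (Fin n)}
    (h : ∀ i, q ≤ (G.neighborSet i).ncard) : q * n ≤ 2 * G.edgeSet.ncard := by
  rw [← sum_ncard_neighborSet]
  calc q * n = ∑ _i : Fin n, q := by simp [mul_comm]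
    _ ≤ _ := Finset.sum_le_sum fun i _ => h i

theorem le_avgDegree {q n : ℕ} (hn : 0 < n) {G : SimpleGraph (Fin n)}
    (h : ∀ i, q ≤ (G.neighborSet i).ncard) : (q : ℝ) ≤ avgDegree G := by
  have := mul_le_two_mul_edges h
  rw [avgDegree, le_div_iff₀ (by positivity)]
  exact_mod_cast this

/-- Base case of the induction that bounds g: all vertices are deleted. -/
theorem hasCliqueMinor_zero {n : ℕ} (G : SimpleGraph (Fin n)) : HasCliqueMinor G 0 := by
  refine ⟨(List.finRange n).map .deleteVertex ++ [], Reaches.producesClique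
    (reaches_deleteVertex _ _ (List.nodup_finRange n) (by simp)) ?_⟩
  refine ⟨?_, ?_⟩ <;> simp

/-- A `K_t`-minor in a neighbourhood gives a `K_{t+1}`-minor. -/
theorem DenseNeighborhood.hasCliqueMinor {n t q d : ℕ} {G : SimpleGraph (Fin n)}
    {X : LabelledGraph (Fin n)} {ops : List (MinorOp (Fin n))} (hX : Reaches ⟨Finset.univ, G⟩ ops X)
    {v : Fin n} {A : SimpleGraph (Fin d)} {φ : Fin d ↪ Fin n} (h : DenseNeighborhood q X v A φ)
    (hA : HasCliqueMinor A t) : HasCliqueMinor G (t + 1) := by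
  obtain ⟨ops', h'⟩ := hA
  set T := Finset.univ.map φ ∪ {v}
  have hT : T ⊆ X.verts := by
    intro x hx
    rcases Finset.mem_union.1 hx with hx | hx
    · obtain ⟨i, -, rfl⟩ := Finset.mem_map.1 hx; exact h.mem i
    · rw [Finset.mem_singleton.1 hx]; exact h.center_mem
  -- After these deletions only the neighbourhood and its centre remain, and the centre plays the
  -- part of the clique `R` in `ProducesClique.map`.
  have hr := reaches_deleteVertex (X.verts \ T).toList X (Finset.nodup_toList _) (by simp +contextual)
  rw [Finset.toList_toFinset, Finset.sdiff_sdiff_eq_self hT] at hr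
  refine ⟨_, (hX.append hr).producesClique (h'.map φ {v} ?_ rfl ?_ ?_ ?_)⟩
  · intro r hr a
    rw [Finset.mem_singleton.1 hr]
    exact (h.adj_center a).ne'
  · exact fun a _ b _ hab => h.adj a b hab
  · intro r hr a _
    rw [Finset.mem_singleton.1 hr]
    exact h.adj_center a
  · simp

/-- `K_{t-1}` has no `K_t`-minor. -/
theorem lt_of_forces_cliqueMinor {t : ℕ} {D : ℝ}
    (hD : ∀ (n : ℕ) (G : SimpleGraph (Fin n)), 0 < n → D ≤ avgDegree G → HasCliqueMinor G (t + 2)) :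
    (t : ℝ) < D := by
  by_contra! hlt
  -- The complete graph on `t + 1` vertices has average degree `t` but too few vertices for a clique
  -- on `t + 2`.
  have hdeg : (t : ℝ) ≤ avgDegree (⊤ : SimpleGraph (Fin (t + 1))) := by
    refine le_avgDegree (by omega) fun i => ?_
    rw [SimpleGraph.neighborSet_top, ← Finset.coe_singleton, ← Finset.coe_compl,
      Set.ncard_coe_finset, Finset.card_compl]
    simp
  obtain ⟨ops, h⟩ := hD (t + 1) ⊤ (by omega) (hlt.trans hdeg)
  have := ProducesClique.le_card h
  simp at this

theorem IsEdgeList.length_eq {n : ℕ} {G : SimpleGraph (Fin n)} {es : List (Fin n × Fin n)}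
    (h : IsEdgeList G es) : es.length = G.edgeSet.ncard := by
  classical
  have : G.edgeSet = ((es.map fun e => s(e.1, e.2)).toFinset : Set (Sym2 (Fin n))) := by
    ext e
    induction e with
    | _ u v => rw [SimpleGraph.mem_edgeSet, ← h.2 u v]; simp
  rw [this, Set.ncard_coe_finset, List.toFinset_card_of_nodup h.1, List.length_map]

theorem exists_isEdgeList {n : ℕ} (G : SimpleGraph (Fin n)) :
    ∃ es : List (Fin n × Fin n), IsEdgeList G es := by
  classical
  refine ⟨G.edgeFinset.toList.map Quot.out, ?_, ?_⟩
  · rw [List.map_map]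
    convert G.edgeFinset.nodup_toList
    convert List.map_id _
    funext e
    exact Quot.out_eq e
  · intro u v
    have : (G.edgeFinset.toList.map Quot.out).map (fun e => s(e.1, e.2)) =
        G.edgeFinset.toList := by
      rw [List.map_map]
      convert List.map_id _
      funext e
      exact Quot.out_eq e
    rw [this]
    simp

/-! ### Reasoning about programs -/

namespace RamExpr

instance : Add RamExpr := ⟨.bin .add⟩
instance : Sub RamExpr := ⟨.bin .sub⟩
instance : Mul RamExpr := ⟨.bin .mul⟩

/-- The expression with value `1` if `a < b` and `0` otherwise. -/
def lt (a b : RamExpr) : RamExpr := .bin .lt a b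

/-- The expression with value `1` if `a = b` and `0` otherwise. -/
def eq (a b : RamExpr) : RamExpr := .bin .eq a b

variable {W : ℕ} {s : RamState} {a b : RamExpr}

@[simp] theorem eval_const (c : ℕ) : (const c).eval s = c := rfl
@[simp] theorem eval_reg (r : ℕ) : (reg r).eval s = s.reg r := rfl
@[simp] theorem eval_load (k : ℕ) : (load k a).eval s = s.mem k (a.eval s) := rfl
@[simp] theorem eval_add : (a + b).eval s = a.eval s + b.eval s := rfl
@[simp] theorem eval_sub : (a - b).eval s = a.eval s - b.eval s := rfl
@[simp] theorem eval_mul : (a * b).eval s = a.eval s * b.eval s := rfl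
@[simp] theorem eval_lt : (lt a b).eval s = if a.eval s < b.eval s then 1 else 0 := rfl
@[simp] theorem eval_eq : (eq a b).eval s = if a.eval s = b.eval s then 1 else 0 := rfl

@[simp] theorem fits_const (c : ℕ) : (const c).Fits W s ↔ c < W := Iff.rfl
@[simp] theorem fits_reg (r : ℕ) : (reg r).Fits W s ↔ s.reg r < W := Iff.rfl
@[simp] theorem fits_load (k : ℕ) : (load k a).Fits W s ↔ a.Fits W s ∧ s.mem k (a.eval s) < W :=
  Iff.rfl
@[simp] theorem fits_add :
    (a + b).Fits W s ↔ a.Fits W s ∧ b.Fits W s ∧ a.eval s + b.eval s < W := Iff.rfl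
@[simp] theorem fits_mul :
    (a * b).Fits W s ↔ a.Fits W s ∧ b.Fits W s ∧ a.eval s * b.eval s < W := Iff.rfl

theorem Fits.eval_lt (h : a.Fits W s) : a.eval s < W := by
  cases a with
  | const c => exact h
  | reg r => exact h
  | load k a => exact h.2
  | bin op a b => exact h.2.2

@[simp] theorem fits_sub : (a - b).Fits W s ↔ a.Fits W s ∧ b.Fits W s :=
  ⟨fun h => ⟨h.1, h.2.1⟩, fun h => ⟨h.1, h.2, (Nat.sub_le _ _).trans_lt h.1.eval_lt⟩⟩

theorem fits_lt (hW : 1 < W) : (lt a b).Fits W s ↔ a.Fits W s ∧ b.Fits W s := by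
  refine ⟨fun h => ⟨h.1, h.2.1⟩, fun h => ⟨h.1, h.2, ?_⟩⟩
  rw [RamOp.eval]
  split <;> omega

theorem fits_eq (hW : 1 < W) : (eq a b).Fits W s ↔ a.Fits W s ∧ b.Fits W s := by
  refine ⟨fun h => ⟨h.1, h.2.1⟩, fun h => ⟨h.1, h.2, ?_⟩⟩
  rw [RamOp.eval]
  split <;> omega

/-- The product of the expressions of a list. -/
def prod : List RamExpr → RamExpr
  | [] => .const 1
  | e :: l => e * prod l

/-- A product of truth values is a truth value and cannot overflow, so products serve as
conjunctions of any length. -/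
theorem fits_prod (hW : 1 < W) : ∀ {l : List RamExpr}, (∀ e ∈ l, e.Fits W s ∧ e.eval s ≤ 1) →
    (prod l).Fits W s ∧ (prod l).eval s ≤ 1
  | [], _ => ⟨hW, le_rfl⟩
  | e :: l, h => by
    have he := h e (by simp)
    have hl := fits_prod hW (l := l) fun e' he' => h e' (by simp [he'])
    have : e.eval s * (prod l).eval s ≤ 1 := Nat.mul_le_mul he.2 hl.2
    exact ⟨⟨he.1, hl.1, this.trans_lt hW⟩, this⟩

theorem eval_prod_ne_zero : ∀ {l : List RamExpr},
    (prod l).eval s ≠ 0 ↔ ∀ e ∈ l, e.eval s ≠ 0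
  | [] => by simp [prod]
  | e :: l => by simp [prod, eval_prod_ne_zero (l := l)]

/-- The sum of the first `k` expressions of a sequence. -/
def sum (f : ℕ → RamExpr) : ℕ → RamExpr
  | 0 => .const 0
  | k + 1 => sum f k + f k

@[simp] theorem eval_sum (f : ℕ → RamExpr) (k : ℕ) :
    (sum f k).eval s = ∑ i ∈ Finset.range k, (f i).eval s := by
  induction k with
  | zero => rfl
  | succ k ih => rw [Finset.sum_range_succ, ← ih]; rfl

theorem fits_sum {f : ℕ → RamExpr} {k : ℕ} (hk : k < W)
    (h : ∀ i < k, (f i).Fits W s ∧ (f i).eval s ≤ 1) :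
    (sum f k).Fits W s ∧ (sum f k).eval s ≤ k := by
  induction k with
  | zero => exact ⟨hk, le_rfl⟩
  | succ k ih =>
    obtain ⟨h₁, h₂⟩ := ih (by omega) fun i hi => h i (by omega)
    obtain ⟨h₃, h₄⟩ := h k (by omega)
    have : (sum f (k + 1)).eval s = (sum f k).eval s + (f k).eval s := rfl
    exact ⟨⟨h₁, h₃, by change _ + _ < W; omega⟩, by omega⟩

end RamExpr

namespace RamState

/-- Writing to a register. -/
def setReg (s : RamState) (r x : ℕ) : RamState := { s with reg := Function.update s.reg r x }

/-- Writing to an array. -/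
def setMem (s : RamState) (b i x : ℕ) : RamState :=
  { s with mem := Function.update s.mem b (Function.update (s.mem b) i x) }

@[simp] theorem reg_setReg (s : RamState) (r x r' : ℕ) :
    (s.setReg r x).reg r' = if r' = r then x else s.reg r' := Function.update_apply _ _ _ _

@[simp] theorem mem_setReg (s : RamState) (r x : ℕ) : (s.setReg r x).mem = s.mem := rfl

@[simp] theorem reg_setMem (s : RamState) (b i x : ℕ) : (s.setMem b i x).reg = s.reg := rfl

@[simp] theorem mem_setMem (s : RamState) (b i x b' i' : ℕ) :
    (s.setMem b i x).mem b' i' = if b' = b ∧ i' = i then x else s.mem b' i' := by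
  simp only [setMem, Function.update_apply]
  by_cases h : b' = b
  · subst h
    by_cases h' : i' = i <;> simp [h']
  · simp [h]

end RamState

/-- A bound for the running time of a program without loops. -/
def RamProg.time : RamProg → ℕ
  | .skip => 1
  | .set _ e => e.cost + 1
  | .store _ a e => a.cost + e.cost + 1
  | .seq p q => p.time + q.time
  | .ite c p q => c.cost + 1 + (p.time + q.time)
  -- A harmless default: any execution of a loop takes a positive number of steps, so `Run` never
  -- holds for a loop.
  | .loop _ _ => 0

/-- Started in the state `s`, the program `p` halts within `p.time` steps in a state that
satisfies `Q`. -/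
def Run (W : ℕ) (p : RamProg) (s : RamState) (Q : RamState → Prop) : Prop :=
  ∃ k s', RamExec W p s k s' ∧ k ≤ p.time ∧ Q s'

namespace Run

variable {W : ℕ} {s : RamState} {Q R : RamState → Prop} {p q : RamProg}

theorem mono (h : Run W p s Q) (hQR : ∀ s', Q s' → R s') : Run W p s R := by
  obtain ⟨k, s', he, hk, hQ⟩ := h
  exact ⟨k, s', he, hk, hQR s' hQ⟩

theorem skip (h : Q s) : Run W .skip s Q := ⟨_, _, .skip s, le_rfl, h⟩

theorem set {r : ℕ} {e : RamExpr} (he : e.Fits W s) (h : Q (s.setReg r (e.eval s))) :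
    Run W (.set r e) s Q :=
  ⟨_, _, .set s r e he, le_rfl, h⟩

theorem store {b : ℕ} {a e : RamExpr} (ha : a.Fits W s) (he : e.Fits W s)
    (h : Q (s.setMem b (a.eval s) (e.eval s))) : Run W (.store b a e) s Q :=
  ⟨_, _, .store s b a e ha he, le_rfl, h⟩

theorem seq (h : Run W p s fun s' => Run W q s' Q) : Run W (.seq p q) s Q := by
  obtain ⟨k, s', he, hk, l, s'', he', hl, hQ⟩ := h
  exact ⟨_, _, .seq p q s s' s'' k l he he', Nat.add_le_add hk hl, hQ⟩

theorem ite {c : RamExpr} (hc : c.Fits W s) (h₁ : c.eval s ≠ 0 → Run W p s Q)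
    (h₂ : c.eval s = 0 → Run W q s Q) : Run W (.ite c p q) s Q := by
  by_cases h : c.eval s = 0
  · obtain ⟨k, s', he, hk, hQ⟩ := h₂ h
    exact ⟨_, _, .iteFalse c p q s s' k hc h he, by rw [RamProg.time]; omega, hQ⟩
  · obtain ⟨k, s', he, hk, hQ⟩ := h₁ h
    exact ⟨_, _, .iteTrue c p q s s' k hc h he, by rw [RamProg.time]; omega, hQ⟩

/-- A loop with an invariant `I m`, where the body decreases `m`, takes time linear in `m`. -/
theorem loop {c : RamExpr} (I : ℕ → RamState → Prop) (hc : ∀ m s, I m s → c.Fits W s)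
    (hp : ∀ m s, I m s → c.eval s ≠ 0 → Run W p s fun s' => ∃ m' < m, I m' s') (m : ℕ) :
    ∀ s, I m s → ∃ k s', RamExec W (.loop c p) s k s' ∧
      k ≤ m * (c.cost + 1 + p.time) + (c.cost + 1) ∧ (∃ m', I m' s') ∧ c.eval s' = 0 := by
  induction m using Nat.strong_induction_on with
  | _ m ih =>
    intro s hI
    by_cases h : c.eval s = 0
    · exact ⟨_, _, .loopFalse c p s (hc m s hI) h, by omega, ⟨m, hI⟩, h⟩
    · obtain ⟨k, s', he, hk, m', hm', hI'⟩ := hp m s hI h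
      obtain ⟨l, s'', he', hl, hI'', h''⟩ := ih m' hm' s' hI'
      refine ⟨_, _, .loopTrue c p s s' s'' k l (hc m s hI) h he he', ?_, hI'', h''⟩
      have : (m' + 1) * (c.cost + 1 + p.time) ≤ m * (c.cost + 1 + p.time) :=
        Nat.mul_le_mul_right _ (by omega)
      rw [Nat.add_mul] at this
      omega

end Run

/-- The `k`-fold repetition of a program. -/
def RamProg.repeat (p : RamProg) : ℕ → RamProg
  | 0 => .skip
  | k + 1 => .seq p (p.repeat k)

theorem Run.repeat {W : ℕ} {p : RamProg} {I : ℕ → RamState → Prop}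
    (hp : ∀ k s, I (k + 1) s → Run W p s (I k)) (k : ℕ) :
    ∀ {s : RamState}, I k s → Run W (p.repeat k) s (I 0) := by
  induction k with
  | zero => exact fun h => Run.skip h
  | succ k ih => exact fun h => Run.seq ((hp k _ h).mono fun _ hs' => ih hs')

/-- Running the first program of a list whose condition holds. -/
def RamProg.switch : List (RamExpr × RamProg) → RamProg
  | [] => .skip
  | e :: l => .ite e.1 e.2 (switch l)

/-- All conditions must fit, since those before the first true one are evaluated as well; the
existence of a true one excludes falling through to `skip`. -/
theorem Run.switch {W : ℕ} {s : RamState} {Q : RamState → Prop} :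
    ∀ {l : List (RamExpr × RamProg)}, (∀ e ∈ l, e.1.Fits W s) →
      (∀ e ∈ l, e.1.eval s ≠ 0 → Run W e.2 s Q) → (∃ e ∈ l, e.1.eval s ≠ 0) →
      Run W (RamProg.switch l) s Q
  | [], _, _, h => by simp at h
  | e :: l, hf, hr, h => by
    refine Run.ite (hf e (by simp)) (hr e (by simp)) fun h0 => ?_
    refine Run.switch (fun e' he' => hf e' (by simp [he'])) (fun e' he' => hr e' (by simp [he'])) ?_
    obtain ⟨e', he', hne⟩ := h
    rcases List.mem_cons.1 he' with rfl | he'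
    · exact absurd h0 hne
    · exact ⟨e', he', hne⟩

/-! ### Neighbour lists with an adjacency matrix

Register `2` holds the number `n` of vertices. For a vertex `a`, the cell `a` of the array `5` holds
the degree of `a`, the cells `i * n + a` of the array `6`, for `i` less than the degree, list the
neighbours of `a`, and the cell `a * n + b` of the array `7` holds `i + 1` if `b` is the `i`-th
neighbour of `a`, and `0` if `b` is not a neighbour. -/

/-- Uniqueness of quotient and remainder modulo `n`. It separates the cells touched by an update
from all others. -/
theorem addr_eq_iff {n i j : ℕ} {a b : Fin n} :
    i * n + (a : ℕ) = j * n + (b : ℕ) ↔ i = j ∧ a = b := by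
  constructor
  · intro h
    have hn : 0 < n := a.pos
    have h₁ := congrArg (· / n) h
    have h₂ := congrArg (· % n) h
    simp only [Nat.mul_comm _ n, Nat.mul_add_div hn, Nat.div_eq_of_lt a.2, Nat.div_eq_of_lt b.2,
      Nat.mul_add_mod, Nat.mod_eq_of_lt a.2, Nat.mod_eq_of_lt b.2] at h₁ h₂
    exact ⟨by omega, Fin.ext h₂⟩
  · rintro ⟨rfl, rfl⟩; rfl

/-- The degree of a vertex. -/
def degE (a : RamExpr) : RamExpr := .load 5 a

/-- The `i`-th neighbour of a vertex. -/
def nbrE (i a : RamExpr) : RamExpr := .load 6 (i * .reg 2 + a)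

/-- The entry of the adjacency matrix. -/
def posE (a b : RamExpr) : RamExpr := .load 7 (a * .reg 2 + b)

/-- The memory of `s` represents the directed graph in which the vertex `a` has the set `N a` of
out-neighbours. -/
structure Stores (n : ℕ) (s : RamState) (N : Fin n → Finset (Fin n)) : Prop where
  size : s.reg 2 = n
  deg : ∀ a : Fin n, s.mem 5 a = (N a).card
  list : ∀ a : Fin n, ∀ i < (N a).card,
    ∃ b ∈ N a, s.mem 6 (i * n + a) = b ∧ s.mem 7 (a * n + b) = i + 1
  pos : ∀ a : Fin n, ∀ b ∈ N a,
    ∃ i < (N a).card, s.mem 7 (a * n + b) = i + 1 ∧ s.mem 6 (i * n + a) = b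
  pos_zero : ∀ a : Fin n, ∀ b ∉ N a, s.mem 7 (a * n + b) = 0
  -- Demanded also of cells beyond the degree: such cells are read by expressions that evaluate a
  -- fixed number of list entries, and their values serve as addresses.
  label : ∀ i, s.mem 6 i < n

/-- The states agree up to the representation of the graph. -/
def SameRest (s s' : RamState) : Prop :=
  s'.reg = s.reg ∧ ∀ k i, k ≠ 5 → k ≠ 6 → k ≠ 7 → s'.mem k i = s.mem k i

theorem SameRest.trans {s s' s'' : RamState} (h : SameRest s s') (h' : SameRest s' s'') : SameRest s s'' :=
  ⟨h'.1.trans h.1, fun k i h₅ h₆ h₇ => (h'.2 k i h₅ h₆ h₇).trans (h.2 k i h₅ h₆ h₇)⟩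

namespace Stores

variable {n : ℕ} {s : RamState} {N : Fin n → Finset (Fin n)}

theorem congr (h : Stores n s N) {s' : RamState} (h₂ : s'.reg 2 = s.reg 2)
    (h₅ : ∀ i, s'.mem 5 i = s.mem 5 i) (h₆ : ∀ i, s'.mem 6 i = s.mem 6 i)
    (h₇ : ∀ i, s'.mem 7 i = s.mem 7 i) : Stores n s' N where
  size := h₂.trans h.size
  deg a := (h₅ _).trans (h.deg a)
  list a i hi := by simpa only [h₆, h₇] using h.list a i hi
  pos a b hb := by simpa only [h₆, h₇] using h.pos a b hb
  pos_zero a b hb := (h₇ _).trans (h.pos_zero a b hb)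
  label i := by rw [h₆]; exact h.label i

theorem pos_ne_zero_iff (h : Stores n s N) {a b : Fin n} : s.mem 7 (a * n + b) ≠ 0 ↔ b ∈ N a := by
  constructor
  · intro h0
    by_contra hb
    exact h0 (h.pos_zero a b hb)
  · intro hb
    obtain ⟨i, -, hi, -⟩ := h.pos a b hb
    omega

theorem pos_le (h : Stores n s N) (a b : Fin n) : s.mem 7 (a * n + b) ≤ n := by
  by_cases hb : b ∈ N a
  · obtain ⟨i, hi, hi', -⟩ := h.pos a b hb
    have : (N a).card ≤ n := by simpa using (N a).card_le_univ
    omega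
  · rw [h.pos_zero a b hb]; omega

theorem card_le (_h : Stores n s N) (a : Fin n) : (N a).card ≤ n := by
  simpa using (N a).card_le_univ

/-- The label in a cell of the neighbour lists. -/
def nbr (h : Stores n s N) (i : ℕ) (a : Fin n) : Fin n := ⟨s.mem 6 (i * n + a), h.label _⟩

theorem nbr_mem (h : Stores n s N) {i : ℕ} {a : Fin n} (hi : i < (N a).card) : h.nbr i a ∈ N a := by
  obtain ⟨b, hb, hb', -⟩ := h.list a i hi
  have : h.nbr i a = b := Fin.ext hb'
  rwa [this]

theorem nbr_injOn (h : Stores n s N) (a : Fin n) :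
    Set.InjOn (fun i => h.nbr i a) (Finset.range (N a).card) := by
  intro i hi j hj hij
  obtain ⟨b, hb, hb', hbi⟩ := h.list a i (by simpa using hi)
  obtain ⟨c, hc, hc', hcj⟩ := h.list a j (by simpa using hj)
  have : b = c := by
    have h₁ : h.nbr i a = b := Fin.ext hb'
    have h₂ : h.nbr j a = c := Fin.ext hc'
    rw [← h₁, ← h₂]; exact hij
  subst this
  omega

theorem image_nbr (h : Stores n s N) (a : Fin n) :
    (Finset.range (N a).card).image (fun i => h.nbr i a) = N a := by
  ext b
  simp only [Finset.mem_image, Finset.mem_range]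
  constructor
  · rintro ⟨i, hi, rfl⟩
    exact h.nbr_mem hi
  · intro hb
    obtain ⟨i, hi, -, hi'⟩ := h.pos a b hb
    exact ⟨i, hi, Fin.ext hi'⟩

end Stores

theorem mul_add_lt_of_sq_le {n W x y : ℕ} (hW : (n + 2) * (n + 2) ≤ W) (hx : x ≤ n) (hy : y ≤ n) :
    x * n + y < W := by
  have : x * n ≤ n * n := Nat.mul_le_mul_right _ hx
  nlinarith

/-- Adding the arc from the label in register `a` to the label in register `b`. -/
def addArc (a b : ℕ) : RamProg :=
  .seq (.store 6 (degE (.reg a) * .reg 2 + .reg a) (.reg b))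
  (.seq (.store 5 (.reg a) (degE (.reg a) + .const 1))
  (.store 7 (.reg a * .reg 2 + .reg b) (degE (.reg a))))

/-- Removing the arc from the label in register `a` to the label in register `b`. -/
def removeArc (a b : ℕ) : RamProg :=
  .seq (.store 6 ((posE (.reg a) (.reg b) - .const 1) * .reg 2 + .reg a)
    (nbrE (degE (.reg a) - .const 1) (.reg a)))
  (.seq (.store 7 (.reg a * .reg 2 + nbrE (degE (.reg a) - .const 1) (.reg a))
    (posE (.reg a) (.reg b)))
  -- The order matters: if the removed neighbour is itself the last of the list, this zero has to
  -- overwrite the position just written.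
  (.seq (.store 7 (.reg a * .reg 2 + .reg b) (.const 0))
  (.store 5 (.reg a) (degE (.reg a) - .const 1))))

theorem Stores.addArc {n : ℕ} {s s' : RamState} {N : Fin n → Finset (Fin n)} (h : Stores n s N)
    {a b : Fin n} (hab : b ∉ N a) (h₂ : s'.reg 2 = s.reg 2)
    (h₅ : ∀ i, s'.mem 5 i = if i = a then (N a).card + 1 else s.mem 5 i)
    (h₆ : ∀ i, s'.mem 6 i = if i = (N a).card * n + a then (b : ℕ) else s.mem 6 i)
    (h₇ : ∀ i, s'.mem 7 i = if i = a * n + b then (N a).card + 1 else s.mem 7 i) :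
    Stores n s' (Function.update N a (insert b (N a))) := by
  refine ⟨h₂.trans h.size, fun c => ?_, fun c i hi => ?_, fun c d hd => ?_, fun c d hd => ?_,
    fun i => ?_⟩
  · rw [h₅]
    by_cases hc : c = a
    · subst hc; simp [hab]
    · simp [hc, Fin.val_inj, h.deg]
  · by_cases hc : c = a
    · subst hc
      simp only [Function.update_self, Finset.card_insert_of_notMem hab] at hi ⊢
      rcases Nat.lt_succ_iff_lt_or_eq.1 hi with hi | rfl
      · obtain ⟨d, hd, hd₁, hd₂⟩ := h.list c i hi
        refine ⟨d, Finset.mem_insert_of_mem hd, ?_, ?_⟩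
        · rw [h₆, if_neg, hd₁]
          rw [addr_eq_iff]; omega
        · rw [h₇, if_neg, hd₂]
          rw [addr_eq_iff]
          rintro ⟨-, rfl⟩; exact hab hd
      · exact ⟨b, Finset.mem_insert_self _ _, by rw [h₆, if_pos rfl], by rw [h₇, if_pos rfl]⟩
    · rw [Function.update_of_ne hc] at hi ⊢
      obtain ⟨d, hd, hd₁, hd₂⟩ := h.list c i hi
      refine ⟨d, hd, ?_, ?_⟩
      · rw [h₆, if_neg, hd₁]
        rw [addr_eq_iff]; exact fun h => hc h.2
      · rw [h₇, if_neg, hd₂]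
        rw [addr_eq_iff]; exact fun h => hc (Fin.ext h.1)
  · by_cases hc : c = a
    · subst hc
      simp only [Function.update_self, Finset.card_insert_of_notMem hab, Finset.mem_insert] at hd ⊢
      by_cases hdb : d = b
      · subst hdb
        exact ⟨(N c).card, by omega, by rw [h₇, if_pos rfl], by rw [h₆, if_pos rfl]⟩
      · obtain ⟨i, hi, hi₁, hi₂⟩ := h.pos c d (hd.resolve_left hdb)
        refine ⟨i, by omega, ?_, ?_⟩
        · rw [h₇, if_neg, hi₁]
          rw [addr_eq_iff]; exact fun h => hdb h.2
        · rw [h₆, if_neg, hi₂]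
          rw [addr_eq_iff]; omega
    · rw [Function.update_of_ne hc] at hd ⊢
      obtain ⟨i, hi, hi₁, hi₂⟩ := h.pos c d hd
      refine ⟨i, hi, ?_, ?_⟩
      · rw [h₇, if_neg, hi₁]
        rw [addr_eq_iff]; exact fun h => hc (Fin.ext h.1)
      · rw [h₆, if_neg, hi₂]
        rw [addr_eq_iff]; exact fun h => hc h.2
  · by_cases hc : c = a
    · subst hc
      simp only [Function.update_self, Finset.mem_insert, not_or] at hd
      rw [h₇, if_neg, h.pos_zero c d hd.2]
      rw [addr_eq_iff]; exact fun h => hd.1 h.2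
    · rw [Function.update_of_ne hc] at hd
      rw [h₇, if_neg, h.pos_zero c d hd]
      rw [addr_eq_iff]; exact fun h => hc (Fin.ext h.1)
  · rw [h₆]
    split
    · exact b.2
    · exact h.label i

theorem Run.addArc {n W : ℕ} {s : RamState} {N : Fin n → Finset (Fin n)} (h : Stores n s N)
    (hW : (n + 2) * (n + 2) ≤ W) {ra rb : ℕ} {a b : Fin n} (ha : s.reg ra = a) (hb : s.reg rb = b)
    (hab : b ∉ N a) {Q : RamState → Prop}
    (hQ : ∀ s', Stores n s' (Function.update N a (insert b (N a))) → SameRest s s' → Q s') :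
    Run W (addArc ra rb) s Q := by
  have hcard := h.card_le a
  have hn : n + 2 < W := by nlinarith [a.pos]
  have hal := a.2
  have hbl := b.2
  have f₁ := mul_add_lt_of_sq_le hW hcard a.2.le
  have f₂ := mul_add_lt_of_sq_le hW a.2.le b.2.le
  have hdeg := h.deg a
  have hsize := h.size
  refine .seq (.store ?_ ?_ (.seq (.store ?_ ?_ (.store ?_ ?_ (hQ _ (h.addArc hab ?_ ?_ ?_ ?_) ?_)))))
  all_goals simp [degE, ha, hb, hdeg, hsize]
  all_goals try omega
  constructor
  · simp
  · intro k i h5 h6 h7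
    simp [h5, h6, h7]

/-- The last neighbour `l` takes over the position `p` of `b`, so the list keeps no gap and
constantly many cells change. If `l = b`, the list only gets shorter. -/
theorem Stores.removeArc {n : ℕ} {s s' : RamState} {N : Fin n → Finset (Fin n)} (h : Stores n s N)
    {a b : Fin n} (hab : b ∈ N a) (h₂ : s'.reg 2 = s.reg 2)
    (h₅ : ∀ i, s'.mem 5 i = if i = a then (N a).card - 1 else s.mem 5 i)
    (h₆ : ∀ i, s'.mem 6 i = if i = (s.mem 7 (a * n + b) - 1) * n + a then
      s.mem 6 (((N a).card - 1) * n + a) else s.mem 6 i)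
    (h₇ : ∀ i, s'.mem 7 i = if i = a * n + b then 0 else
      if i = a * n + s.mem 6 (((N a).card - 1) * n + a) then s.mem 7 (a * n + b) else s.mem 7 i) :
    Stores n s' (Function.update N a ((N a).erase b)) := by
  have hcard := Finset.card_erase_of_mem hab
  have hpos : 0 < (N a).card := Finset.card_pos.2 ⟨b, hab⟩
  obtain ⟨p, hp, hp₁, hp₂⟩ := h.pos a b hab
  obtain ⟨l, hl, hl₁, hl₂⟩ := h.list a ((N a).card - 1) (by omega)
  rw [hp₁, Nat.add_sub_cancel, hl₁] at h₆
  rw [hl₁, hp₁] at h₇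
  refine ⟨h₂.trans h.size, fun c => ?_, fun c i hi => ?_, fun c d hd => ?_, fun c d hd => ?_,
    fun i => ?_⟩
  · rw [h₅]
    by_cases hc : c = a
    · subst hc; simp [hcard]
    · simp [hc, Fin.val_inj, h.deg]
  · by_cases hc : c = a
    · subst hc
      simp only [Function.update_self, hcard] at hi ⊢
      by_cases hip : i = p
      · subst hip
        have hlb : l ≠ b := by rintro rfl; omega
        refine ⟨l, Finset.mem_erase.2 ⟨hlb, hl⟩, by rw [h₆, if_pos rfl], ?_⟩
        rw [h₇, if_neg, if_pos rfl]
        rw [addr_eq_iff]; exact fun h => hlb h.2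
      · obtain ⟨d, hd, hd₁, hd₂⟩ := h.list c i (by omega)
        have hdb : d ≠ b := by rintro rfl; omega
        have hdl : d ≠ l := by rintro rfl; omega
        refine ⟨d, Finset.mem_erase.2 ⟨hdb, hd⟩, ?_, ?_⟩
        · rw [h₆, if_neg, hd₁]
          rw [addr_eq_iff]; exact fun h => hip h.1
        · rw [h₇, if_neg, if_neg, hd₂]
          · rw [addr_eq_iff]; exact fun h => hdl h.2
          · rw [addr_eq_iff]; exact fun h => hdb h.2
    · rw [Function.update_of_ne hc] at hi ⊢
      obtain ⟨d, hd, hd₁, hd₂⟩ := h.list c i hi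
      refine ⟨d, hd, ?_, ?_⟩
      · rw [h₆, if_neg, hd₁]
        rw [addr_eq_iff]; exact fun h => hc h.2
      · rw [h₇, if_neg, if_neg, hd₂]
        · rw [addr_eq_iff]; exact fun h => hc (Fin.ext h.1)
        · rw [addr_eq_iff]; exact fun h => hc (Fin.ext h.1)
  · by_cases hc : c = a
    · subst hc
      simp only [Function.update_self, hcard, Finset.mem_erase] at hd ⊢
      by_cases hdl : d = l
      · subst hdl
        refine ⟨p, ?_, ?_, by rw [h₆, if_pos rfl]⟩
        · have : p ≠ (N c).card - 1 := by
            rintro rfl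
            exact hd.1 (Fin.ext (hl₁.symm.trans hp₂))
          omega
        · rw [h₇, if_neg, if_pos rfl]
          rw [addr_eq_iff]; exact fun h => hd.1 h.2
      · obtain ⟨i, hi, hi₁, hi₂⟩ := h.pos c d hd.2
        have hi' : i ≠ (N c).card - 1 := by
          rintro rfl
          exact hdl (Fin.ext (hi₂.symm.trans hl₁))
        have hip : i ≠ p := by
          rintro rfl
          exact hd.1 (Fin.ext (hi₂.symm.trans hp₂))
        refine ⟨i, by omega, ?_, ?_⟩
        · rw [h₇, if_neg, if_neg, hi₁]
          · rw [addr_eq_iff]; exact fun h => hdl h.2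
          · rw [addr_eq_iff]; exact fun h => hd.1 h.2
        · rw [h₆, if_neg, hi₂]
          rw [addr_eq_iff]; exact fun h => hip h.1
    · rw [Function.update_of_ne hc] at hd ⊢
      obtain ⟨i, hi, hi₁, hi₂⟩ := h.pos c d hd
      refine ⟨i, hi, ?_, ?_⟩
      · rw [h₇, if_neg, if_neg, hi₁]
        · rw [addr_eq_iff]; exact fun h => hc (Fin.ext h.1)
        · rw [addr_eq_iff]; exact fun h => hc (Fin.ext h.1)
      · rw [h₆, if_neg, hi₂]
        rw [addr_eq_iff]; exact fun h => hc h.2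
  · by_cases hc : c = a
    · subst hc
      simp only [Function.update_self, Finset.mem_erase, not_and] at hd
      by_cases hdb : d = b
      · rw [h₇, if_pos (by rw [hdb])]
      · have hdN := hd hdb
        rw [h₇, if_neg, if_neg, h.pos_zero c d hdN]
        · rw [addr_eq_iff]; rintro ⟨-, rfl⟩; exact hdN hl
        · rw [addr_eq_iff]; exact fun h => hdb h.2
    · rw [Function.update_of_ne hc] at hd
      rw [h₇, if_neg, if_neg, h.pos_zero c d hd]
      · rw [addr_eq_iff]; exact fun h => hc (Fin.ext h.1)
      · rw [addr_eq_iff]; exact fun h => hc (Fin.ext h.1)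
  · rw [h₆]
    split
    · exact l.2
    · exact h.label i

theorem Run.removeArc {n W : ℕ} {s : RamState} {N : Fin n → Finset (Fin n)} (h : Stores n s N)
    (hW : (n + 2) * (n + 2) ≤ W) {ra rb : ℕ} {a b : Fin n} (ha : s.reg ra = a) (hb : s.reg rb = b)
    (hab : b ∈ N a) {Q : RamState → Prop}
    (hQ : ∀ s', Stores n s' (Function.update N a ((N a).erase b)) → SameRest s s' → Q s') :
    Run W (removeArc ra rb) s Q := by
  have hcard := h.card_le a
  have hpos : 0 < (N a).card := Finset.card_pos.2 ⟨b, hab⟩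
  have hn : n + 2 < W := by nlinarith [a.pos]
  have hal := a.2
  have hbl := b.2
  have f₁ := mul_add_lt_of_sq_le hW (x := (N a).card - 1) (by omega) a.2.le
  have f₂ := mul_add_lt_of_sq_le hW a.2.le b.2.le
  have hdeg := h.deg a
  have hsize := h.size
  obtain ⟨p, hp, hp₁, hp₂⟩ := h.pos a b hab
  obtain ⟨l, hl, hl₁, hl₂⟩ := h.list a ((N a).card - 1) (by omega)
  have hll := l.2
  have f₃ := mul_add_lt_of_sq_le hW (x := p) (by omega) a.2.le
  have f₄ := mul_add_lt_of_sq_le hW a.2.le l.2.le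
  refine .seq (.store ?_ ?_ (.seq (.store ?_ ?_ (.seq (.store ?_ ?_ (.store ?_ ?_
    (hQ _ (h.removeArc hab ?_ ?_ ?_ ?_) ?_)))))))
  all_goals simp [degE, posE, nbrE, ha, hb, hdeg, hsize, hp₁, hl₁]
  all_goals try omega
  constructor
  · simp
  · intro k i h5 h6 h7
    simp [h5, h6, h7]

/-! ### Undirected graphs -/

/-- The finite set of neighbours of a vertex. -/
noncomputable def nbrs {n : ℕ} (H : SimpleGraph (Fin n)) (a : Fin n) : Finset (Fin n) := by
  classical exact Finset.univ.filter (H.Adj a)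

section Nbrs

variable {n : ℕ} {H : SimpleGraph (Fin n)}

@[simp] theorem mem_nbrs {a b : Fin n} : b ∈ nbrs H a ↔ H.Adj a b := by simp [nbrs]

theorem coe_nbrs (a : Fin n) : (nbrs H a : Set (Fin n)) = H.neighborSet a := by ext; simp

theorem sum_card_nbrs : ∑ a, (nbrs H a).card = 2 * H.edgeSet.ncard := by
  rw [← sum_ncard_neighborSet]
  exact Finset.sum_congr rfl fun a _ => by rw [← coe_nbrs, Set.ncard_coe_finset]

theorem nbrs_mono {H' : SimpleGraph (Fin n)} (h : H ≤ H') (a : Fin n) : nbrs H a ⊆ nbrs H' a :=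
  fun _ hb => mem_nbrs.2 (h (mem_nbrs.1 hb))

/-- The nested updates have the form that two successive calls of `removeArc` produce. -/
theorem nbrs_deleteEdges {a b : Fin n} (hab : a ≠ b) :
    nbrs (H.deleteEdges {s(a, b)}) =
      Function.update (Function.update (nbrs H) a ((nbrs H a).erase b)) b
        ((Function.update (nbrs H) a ((nbrs H a).erase b) b).erase a) := by
  funext c
  ext d
  rcases eq_or_ne c b with rfl | hcb
  · simp [SimpleGraph.deleteEdges_adj, hab.symm]
    tauto
  · rw [Function.update_of_ne hcb]
    rcases eq_or_ne c a with rfl | hca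
    · simp [SimpleGraph.deleteEdges_adj, hab]; tauto
    · simp [SimpleGraph.deleteEdges_adj, hca, hcb]

theorem nbrs_sup_edge {a b : Fin n} (hab : a ≠ b) :
    nbrs (H ⊔ SimpleGraph.edge a b) =
      Function.update (Function.update (nbrs H) a (insert b (nbrs H a))) b
        (insert a (Function.update (nbrs H) a (insert b (nbrs H a)) b)) := by
  funext c
  ext d
  rcases eq_or_ne c b with rfl | hcb
  · simp [SimpleGraph.edge_adj, hab.symm]
    grind
  · rw [Function.update_of_ne hcb]
    rcases eq_or_ne c a with rfl | hca
    · simp [SimpleGraph.edge_adj, hab]; grind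
    · simp [SimpleGraph.edge_adj, hca, hcb]

theorem ncard_edgeSet_deleteEdges {a b : Fin n} (hab : H.Adj a b) :
    (H.deleteEdges {s(a, b)}).edgeSet.ncard + 1 = H.edgeSet.ncard := by
  rw [SimpleGraph.edgeSet_deleteEdges]
  exact Set.ncard_sdiff_singleton_add_one (by simpa using hab)

theorem ncard_edgeSet_sup_edge {a b : Fin n} (hab : a ≠ b) (h : ¬ H.Adj a b) :
    (H ⊔ SimpleGraph.edge a b).edgeSet.ncard = H.edgeSet.ncard + 1 := by
  rw [SimpleGraph.edgeSet_sup, SimpleGraph.edgeSet_edge_of_ne hab, Set.union_singleton,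
    Set.ncard_insert_of_notMem (by simpa using h)]

end Nbrs

/-- Pushing the label in register `r` on the stack. -/
def push (r : ℕ) : RamProg := .seq (.store 9 (.reg 3) (.reg r)) (.set 3 (.reg 3 + .const 1))

/-- Adding the edge between the labels in the registers `a` and `b`. -/
def addEdge (a b : ℕ) : RamProg := .seq (addArc a b) (addArc b a)

/-- Removing the edge between the labels in the registers `6` and `8` and pushing both ends on the
stack. -/
def removeEdge : RamProg :=
  .seq (removeArc 6 8) (.seq (removeArc 8 6) (.seq (push 6) (push 8)))

theorem Run.addEdge {n W : ℕ} {s : RamState} {H : SimpleGraph (Fin n)} (h : Stores n s (nbrs H))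
    (hW : (n + 2) * (n + 2) ≤ W) {ra rb : ℕ} {a b : Fin n} (ha : s.reg ra = a) (hb : s.reg rb = b)
    (hne : a ≠ b) (hab : ¬ H.Adj a b) {Q : RamState → Prop}
    (hQ : ∀ s', Stores n s' (nbrs (H ⊔ SimpleGraph.edge a b)) → SameRest s s' → Q s') :
    Run W (addEdge ra rb) s Q := by
  refine .seq (.addArc h hW ha hb (by simpa using hab) fun s₁ h₁ hs₁ => ?_)
  refine .addArc h₁ hW (by rw [hs₁.1, hb]) (by rw [hs₁.1, ha]) ?_ fun s₂ h₂ hs₂ => ?_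
  · simpa [Function.update_of_ne hne.symm] using fun h => hab h.symm
  · rw [← nbrs_sup_edge hne] at h₂
    exact hQ s₂ h₂ (hs₁.trans hs₂)

theorem Run.removeEdge {n W : ℕ} {s : RamState} {H : SimpleGraph (Fin n)}
    (h : Stores n s (nbrs H)) (hW : (n + 2) * (n + 2) ≤ W) (hsp : s.reg 3 + 2 < W) {a b : Fin n}
    (ha : s.reg 6 = a) (hb : s.reg 8 = b) (hab : H.Adj a b) {Q : RamState → Prop}
    (hQ : ∀ s', Stores n s' (nbrs (H.deleteEdges {s(a, b)})) →
      (∀ r, s'.reg r = if r = 3 then s.reg 3 + 2 else s.reg r) →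
      (∀ i, s'.mem 9 i = if i = s.reg 3 + 1 then (b : ℕ) else
        if i = s.reg 3 then (a : ℕ) else s.mem 9 i) →
      (∀ k i, k ≠ 5 → k ≠ 6 → k ≠ 7 → k ≠ 9 → s'.mem k i = s.mem k i) → Q s') :
    Run W removeEdge s Q := by
  have hal := a.2
  have hbl := b.2
  have hn : n < W := by nlinarith
  refine .seq (.removeArc h hW ha hb (by simpa using hab) fun s₁ h₁ hs₁ => ?_)
  refine .seq (.removeArc h₁ hW (by rw [hs₁.1, hb]) (by rw [hs₁.1, ha]) ?_ fun s₂ h₂ hs₂ => ?_)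
  · simpa [Function.update_of_ne hab.ne'] using hab.symm
  rw [← nbrs_deleteEdges hab.ne] at h₂
  have hs := hs₁.trans hs₂
  refine .seq (.seq (.store ?_ ?_ (.set ?_ (.seq (.store ?_ ?_ (.set ?_ (hQ _
    (h₂.congr ?_ ?_ ?_ ?_) ?_ ?_ ?_)))))))
  all_goals simp [hs.1, ha, hb]
  all_goals try omega
  · intro r
    split <;> rfl
  · intro i
    rw [hs.2 _ _ (by decide) (by decide) (by decide)]
  · intro k i h5 h6 h7 h9
    simp [h9, hs.2 k i h5 h6 h7]

/-! ### Output -/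

/-- Writing the operation `(c, u, v)` to the output. -/
def emit (c : ℕ) (u v : RamExpr) : RamProg :=
  .seq (.store 2 (.reg 0) (.const c)) (.seq (.store 3 (.reg 0) u) (.seq (.store 4 (.reg 0) v)
    (.set 0 (.reg 0 + .const 1))))

theorem RamState.Outputs.congr {n : ℕ} {s s' : RamState} {ops : List (MinorOp (Fin n))}
    (h : s.Outputs ops) (h₀ : s'.reg 0 = s.reg 0) (h₂ : ∀ i, s'.mem 2 i = s.mem 2 i)
    (h₃ : ∀ i, s'.mem 3 i = s.mem 3 i) (h₄ : ∀ i, s'.mem 4 i = s.mem 4 i) : s'.Outputs ops := by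
  refine ⟨h₀.trans h.1, fun i hi => ?_⟩
  rw [h₂, h₃, h₄]
  exact h.2 i hi

theorem RamState.Outputs.snoc {n : ℕ} {s s' : RamState} {ops : List (MinorOp (Fin n))}
    (h : s.Outputs ops) {c u v : ℕ} {op : MinorOp (Fin n)} (hop : op.EncodedBy c u v)
    (h₀ : s'.reg 0 = s.reg 0 + 1) (h₂ : ∀ i, s'.mem 2 i = if i = s.reg 0 then c else s.mem 2 i)
    (h₃ : ∀ i, s'.mem 3 i = if i = s.reg 0 then u else s.mem 3 i)
    (h₄ : ∀ i, s'.mem 4 i = if i = s.reg 0 then v else s.mem 4 i) :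
    s'.Outputs (ops ++ [op]) := by
  have hlen := h.1
  refine ⟨by simp [h₀, hlen], fun i hi => ?_⟩
  rw [h₂, h₃, h₄]
  rw [List.length_append, List.length_singleton] at hi
  rcases Nat.lt_succ_iff_lt_or_eq.1 hi with hi' | rfl
  · rw [List.getElem_append_left hi', if_neg (by omega), if_neg (by omega), if_neg (by omega)]
    exact h.2 i hi'
  · simpa [hlen] using hop

/-- Only the output differs. -/
def OnlyOutput (s s' : RamState) : Prop :=
  (∀ r, s'.reg r = if r = 0 then s.reg 0 + 1 else s.reg r) ∧
    ∀ k i, k ≠ 2 → k ≠ 3 → k ≠ 4 → s'.mem k i = s.mem k i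

theorem Stores.of_onlyOutput {n : ℕ} {s s' : RamState} {N : Fin n → Finset (Fin n)}
    (h : Stores n s N) (hs : OnlyOutput s s') : Stores n s' N :=
  h.congr (by simp [hs.1]) (fun i => hs.2 _ _ (by decide) (by decide) (by decide))
    (fun i => hs.2 _ _ (by decide) (by decide) (by decide))
    (fun i => hs.2 _ _ (by decide) (by decide) (by decide))

/-- The operands are evaluated after part of the output has been written. Hence their values are
required in every state that differs from `s` in the output arrays only. -/
theorem Run.emit {n W : ℕ} {s : RamState} {ops : List (MinorOp (Fin n))} (h : s.Outputs ops)
    (h₀ : s.reg 0 + 1 < W) {c : ℕ} {u v : RamExpr} {x y : ℕ} (hc : c < W)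
    (hu : ∀ s', (∀ r, s'.reg r = s.reg r) → (∀ k i, k ≠ 2 → k ≠ 3 → k ≠ 4 → s'.mem k i = s.mem k i) →
      u.Fits W s' ∧ u.eval s' = x)
    (hv : ∀ s', (∀ r, s'.reg r = s.reg r) → (∀ k i, k ≠ 2 → k ≠ 3 → k ≠ 4 → s'.mem k i = s.mem k i) →
      v.Fits W s' ∧ v.eval s' = y)
    {op : MinorOp (Fin n)} (hop : op.EncodedBy c x y) {Q : RamState → Prop}
    (hQ : ∀ s', s'.Outputs (ops ++ [op]) → OnlyOutput s s' → Q s') :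
    Run W (emit c u v) s Q := by
  have hu₁ := hu (s.setMem 2 (s.reg 0) c) (by simp) (by simp +contextual)
  have hv₁ := hv ((s.setMem 2 (s.reg 0) c).setMem 3 (s.reg 0) x) (by simp) (by simp +contextual)
  refine .seq (.store ?_ ?_ (.seq (.store ?_ ?_ (.seq (.store ?_ ?_ (.set ?_
    (hQ _ (h.snoc hop ?_ ?_ ?_ ?_) ⟨?_, ?_⟩)))))))
  all_goals try simp [hu₁, hv₁, hc]
  all_goals try omega
  all_goals simp +contextual

/-! ### The main loop

Registers: `0` length of the output, `2` number of vertices, `3` height of the stack, `4` a lower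
bound for the labels present, `5` whether a dense neighbourhood was found, `6` current vertex,
`7` and `8` neighbours of it. Arrays: `2`, `3`, `4` output, `5`, `6`, `7` graph, `8` whether a label is
absent, `9` stack of vertices. -/

/-- The state `s` represents a subgraph `H` of a minor `X` of `G`, and every vertex of degree at
most `b`, except possibly those in `T`, is on the stack. -/
structure Represents {n : ℕ} (G : SimpleGraph (Fin n)) (b : ℕ) (T : Set (Fin n)) (s : RamState)
    (H : SimpleGraph (Fin n)) (X : LabelledGraph (Fin n)) (ops : List (MinorOp (Fin n))) :
    Prop where
  stores : Stores n s (nbrs H)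
  reaches : Reaches ⟨Finset.univ, G⟩ ops X
  outputs : s.Outputs ops
  -- Only an inclusion, so that edges can be dropped from `H` without an operation in the output.
  le : H ≤ X.graph
  absent : ∀ a : Fin n, s.mem 8 a = if a ∈ X.verts then 0 else 1
  stack_lt : ∀ i, s.mem 9 i < n
  -- The stack may also contain duplicates, absent vertices and vertices of large degree; these are
  -- recognised when they are popped.
  stack : ∀ a ∈ X.verts, a ∉ T → (nbrs H a).card ≤ b → ∃ i < s.reg 3, s.mem 9 i = a
  first : ∀ a ∈ X.verts, s.reg 4 ≤ a
  first_le : s.reg 4 ≤ n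
  -- Every operation written so far removed a vertex, so the length of the output fits into a word.
  output_le : s.reg 0 + X.verts.card ≤ n

theorem Represents.congr {n b : ℕ} {G : SimpleGraph (Fin n)} {T : Set (Fin n)} {s s' : RamState}
    {H : SimpleGraph (Fin n)} {X : LabelledGraph (Fin n)} {ops : List (MinorOp (Fin n))}
    (h : Represents G b T s H X ops) (hm : s'.mem = s.mem)
    (hr : ∀ r, r ≠ 5 → r ≠ 6 → r ≠ 7 → r ≠ 8 → s'.reg r = s.reg r) :
    Represents G b T s' H X ops where
  stores := h.stores.congr (hr _ (by decide) (by decide) (by decide) (by decide)) (by simp [hm])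
    (by simp [hm]) (by simp [hm])
  reaches := h.reaches
  outputs := h.outputs.congr (hr _ (by decide) (by decide) (by decide) (by decide)) (by simp [hm])
    (by simp [hm]) (by simp [hm])
  le := h.le
  absent := by simpa [hm] using h.absent
  stack_lt := by simpa [hm] using h.stack_lt
  stack := by
    rw [hr 3 (by decide) (by decide) (by decide) (by decide), hm]; exact h.stack
  first := by
    rw [hr 4 (by decide) (by decide) (by decide) (by decide)]; exact h.first
  first_le := by
    rw [hr 4 (by decide) (by decide) (by decide) (by decide)]; exact h.first_le
  output_le := by
    rw [hr 0 (by decide) (by decide) (by decide) (by decide)]; exact h.output_le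

/-! ### Contraction, one edge at a time -/

/-- The common neighbours of `u` and `v`, together with `u` if it is a neighbour of `v`: the edges
at `v` that are lost in the contraction of `uv`. -/
noncomputable def lostNbrs {n : ℕ} (H : SimpleGraph (Fin n)) (u v : Fin n) : Finset (Fin n) := by
  classical exact (nbrs H v).filter fun w => w = u ∨ H.Adj u w

section Lost

variable {n : ℕ} {H : SimpleGraph (Fin n)} {u v w : Fin n}

theorem mem_lostNbrs : w ∈ lostNbrs H u v ↔ H.Adj v w ∧ (w = u ∨ H.Adj u w) := by
  simp [lostNbrs]

/-- An edge that vanishes during the contraction is paid for by its end `w`, which ceases to be a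
lost neighbour. So the edge bound in `Contracting` persists. -/
theorem card_lostNbrs_deleteEdges (hw : w ∈ lostNbrs H u v) :
    (lostNbrs (H.deleteEdges {s(v, w)}) u v).card + 1 ≤ (lostNbrs H u v).card := by
  rw [← Finset.card_erase_add_one hw, Nat.add_le_add_iff_right]
  refine Finset.card_le_card fun x hx => ?_
  simp only [mem_lostNbrs, Finset.mem_erase, SimpleGraph.deleteEdges_adj, Set.mem_singleton_iff,
    Sym2.eq_iff] at hx ⊢
  grind

/-- No lost neighbour is created: `w` is the only vertex that becomes adjacent to `u`, and it is no
longer adjacent to `v`. -/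
theorem card_lostNbrs_move (huv : u ≠ v) (hvw : H.Adj v w) (hwu : w ≠ u) :
    (lostNbrs (H.deleteEdges {s(v, w)} ⊔ SimpleGraph.edge u w) u v).card ≤
      (lostNbrs H u v).card := by
  have := hvw.ne
  refine Finset.card_le_card fun x hx => ?_
  simp only [mem_lostNbrs, SimpleGraph.sup_adj, SimpleGraph.edge_adj, SimpleGraph.deleteEdges_adj,
    Set.mem_singleton_iff, Sym2.eq_iff] at hx ⊢
  grind

end Lost

/-- Only the ends of the edge lose degree, and both have just been pushed. -/
theorem Represents.deleteEdge {n b : ℕ} {G : SimpleGraph (Fin n)} {T : Set (Fin n)}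
    {s s' : RamState} {H : SimpleGraph (Fin n)} {X : LabelledGraph (Fin n)}
    {ops : List (MinorOp (Fin n))} (h : Represents G b T s H X ops) {v w : Fin n}
    (hs : Stores n s' (nbrs (H.deleteEdges {s(v, w)})))
    (hr : ∀ r, s'.reg r = if r = 3 then s.reg 3 + 2 else s.reg r)
    (h₉ : ∀ i, s'.mem 9 i = if i = s.reg 3 + 1 then (w : ℕ) else
        if i = s.reg 3 then (v : ℕ) else s.mem 9 i)
    (hm : ∀ k i, k ≠ 5 → k ≠ 6 → k ≠ 7 → k ≠ 9 → s'.mem k i = s.mem k i) :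
    Represents G b T s' (H.deleteEdges {s(v, w)}) X ops where
  stores := hs
  reaches := h.reaches
  outputs := h.outputs.congr (by simp [hr]) (fun i => hm _ _ (by decide) (by decide) (by decide)
    (by decide)) (fun i => hm _ _ (by decide) (by decide) (by decide) (by decide))
    (fun i => hm _ _ (by decide) (by decide) (by decide) (by decide))
  le := (SimpleGraph.deleteEdges_le _).trans h.le
  absent a := by
    rw [hm _ _ (by decide) (by decide) (by decide) (by decide)]; exact h.absent a
  stack_lt i := by
    rw [h₉]
    split
    · exact w.2
    · split
      · exact v.2
      · exact h.stack_lt i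
  stack a ha haT hab := by
    by_cases hav : a = v
    · exact ⟨s.reg 3, by simp [hr], by simp [h₉, hav]⟩
    by_cases haw : a = w
    · exact ⟨s.reg 3 + 1, by simp [hr], by simp [h₉, haw]⟩
    obtain ⟨i, hi, hi'⟩ := h.stack a ha haT (by
      convert hab using 2
      ext x
      simp [SimpleGraph.deleteEdges_adj, hav, haw])
    refine ⟨i, by simp [hr]; omega, ?_⟩
    rw [h₉, if_neg (by omega), if_neg (by omega), hi']
  first a ha := by simpa [hr] using h.first a ha
  first_le := by simpa [hr] using h.first_le
  output_le := by simpa [hr] using h.output_le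

theorem Represents.addEdge {n b : ℕ} {G : SimpleGraph (Fin n)} {T : Set (Fin n)}
    {s s' : RamState} {H : SimpleGraph (Fin n)} {X : LabelledGraph (Fin n)}
    {ops : List (MinorOp (Fin n))} (h : Represents G b T s H X ops) {v w : Fin n}
    (hvw : X.graph.Adj v w) (hs : Stores n s' (nbrs (H ⊔ SimpleGraph.edge v w)))
    (hss : SameRest s s') :
    Represents G b T s' (H ⊔ SimpleGraph.edge v w) X ops where
  stores := hs
  reaches := h.reaches
  outputs := h.outputs.congr (by rw [hss.1]) (fun i => hss.2 _ _ (by decide) (by decide) (by decide))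
    (fun i => hss.2 _ _ (by decide) (by decide) (by decide))
    (fun i => hss.2 _ _ (by decide) (by decide) (by decide))
  le := sup_le h.le fun a c hac => by
    rw [SimpleGraph.edge_adj] at hac
    rcases hac.1 with ⟨rfl, rfl⟩ | ⟨rfl, rfl⟩
    · exact hvw
    · exact hvw.symm
  absent a := by
    rw [hss.2 _ _ (by decide) (by decide) (by decide)]; exact h.absent a
  stack_lt i := by
    rw [hss.2 _ _ (by decide) (by decide) (by decide)]; exact h.stack_lt i
  stack a ha haT hab := by
    obtain ⟨i, hi, hi'⟩ := h.stack a ha haT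
      ((Finset.card_le_card (nbrs_mono le_sup_left a)).trans hab)
    exact ⟨i, by rwa [hss.1], by rw [hss.2 _ _ (by decide) (by decide) (by decide), hi']⟩
  first := by rw [hss.1]; exact h.first
  first_le := by rw [hss.1]; exact h.first_le
  output_le := by rw [hss.1]; exact h.output_le

/-- Moving one edge from the vertex `v` in register `6` to the vertex in register `7`. -/
def moveEdge : RamProg :=
  .ite (degE (.reg 6))
    (.seq (.set 8 (nbrE (.const 0) (.reg 6)))
    (.seq removeEdge
    (.ite (.eq (.reg 8) (.reg 7) + posE (.reg 7) (.reg 8)) .skip (addEdge 7 8))))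
    .skip

/-- The invariant during the contraction of `v` into `u`. -/
structure Contracting {n : ℕ} (G : SimpleGraph (Fin n)) (b q sp e x d : ℕ)
    (T : Set (Fin n)) (u v : Fin n) (s : RamState) (H : SimpleGraph (Fin n)) (X : LabelledGraph (Fin n))
    (ops : List (MinorOp (Fin n))) : Prop extends Represents G b T s H X ops where
  fst : s.reg 6 = v
  snd : s.reg 7 = u
  running : s.reg 5 = 0
  cursor : s.reg 4 = x
  degree_le : (nbrs H v).card ≤ d
  stack_le : s.reg 3 + 2 * d ≤ sp
  edges_le : H.edgeSet.ncard ≤ e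
  le_edges : q * X.verts.card + (lostNbrs H u v).card ≤ H.edgeSet.ncard
  isolated : ∀ a x, H.Adj a x → a ∈ X.verts ∨ a = v

/-- In `X` the contraction is already complete, whereas `H` follows edge by edge. The label `v`
keeps its former edges in `X.graph`, so the inclusion of `H` holds in between; `hX` admits the edge
that is moved to `u`. Each call lowers the degree of `v` and spends two cells of the stack
allowance. -/
theorem Run.moveEdge {n W : ℕ} {G : SimpleGraph (Fin n)} {b q sp e x d : ℕ} {T : Set (Fin n)}
    {u v : Fin n} {s : RamState} {H : SimpleGraph (Fin n)} {X : LabelledGraph (Fin n)}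
    {ops : List (MinorOp (Fin n))} (hW : (n + 2) * (n + 2) ≤ W) (hsp : sp < W) (huv : u ≠ v)
    (hu : u ∈ X.verts) (hX : ∀ w, w ≠ u → X.graph.Adj v w → X.graph.Adj u w)
    (h : Contracting G b q sp e x (d + 1) T u v s H X ops) :
    Run W moveEdge s fun s' => ∃ H', Contracting G b q sp e x d T u v s' H' X ops := by
  have hn : n + 2 < W := by nlinarith [u.pos]
  have hdeg := h.stores.deg v
  have hsize := h.stores.size
  have hv₆ := h.fst
  have hu₇ := h.snd
  have hvl := v.2
  have hul := u.2
  have hcard := h.stores.card_le v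
  have hstack_le := h.stack_le
  refine .ite ?_ (fun hne => ?_) fun h0 => ?_
  · simp [degE, hv₆, hdeg]; omega
  · simp only [degE, RamExpr.eval_load, RamExpr.eval_reg, hv₆, hdeg] at hne
    have hw := h.stores.nbr_mem (i := 0) (a := v) (by omega)
    set w := h.stores.nbr 0 v with hwdef
    have hweq : s.mem 6 (0 * n + v) = w := rfl
    have hwl := w.2
    rw [mem_nbrs] at hw
    have hvw := hw.ne
    refine .seq (.set ?_ (.seq (.removeEdge (H := H) (a := v) (b := w)
      (h.stores.congr ?_ ?_ ?_ ?_) hW ?_ ?_ ?_ hw fun s₁ hs₁ hr₁ h₉₁ hm₁ => ?_)))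
    · simp only [zero_mul, zero_add] at hweq
      simp [nbrE, hv₆, hsize, hweq]; omega
    any_goals simp
    any_goals omega
    · simpa [nbrE, hv₆, hsize] using hweq
    have hset : Represents G b T (s.setReg 8 ((nbrE (.const 0) (.reg 6)).eval s)) H X ops :=
      h.toRepresents.congr (by simp) (by simp +contextual)
    have hs₁' := hset.deleteEdge hs₁ hr₁ h₉₁ hm₁
    have hr6 : s₁.reg 6 = v := by simp [hr₁, hv₆]
    have hr7 : s₁.reg 7 = u := by simp [hr₁, hu₇]
    have hr5 : s₁.reg 5 = 0 := by simp [hr₁, h.running]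
    have hr4 : s₁.reg 4 = x := by simp [hr₁, h.cursor]
    have hr8 : s₁.reg 8 = w := by simpa [hr₁, nbrE, hv₆, hsize] using hweq
    have hr3 : s₁.reg 3 = s.reg 3 + 2 := by simp [hr₁]
    have hpos := hs₁.pos_le u w
    have hadr := mul_add_lt_of_sq_le hW u.2.le w.2.le
    have hE := ncard_edgeSet_deleteEdges hw
    have hdeg' : (nbrs (H.deleteEdges {s(v, w)}) v).card ≤ d := by
      have h1 := h.degree_le
      have : nbrs (H.deleteEdges {s(v, w)}) v = (nbrs H v).erase w := by
        ext x; simp [SimpleGraph.deleteEdges_adj, hvw]; tauto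
      rw [this, Finset.card_erase_of_mem (by simpa using hw)]
      omega
    have hle := h.edges_le
    have hle' := h.le_edges
    refine .ite ?_ (fun hne' => ?_) fun h0' => ?_
    · have : u * n < W := by omega
      simp [posE, hr7, hr8, hs₁.size, RamExpr.fits_eq (show 1 < W by omega)]
      split <;> omega
    · refine .skip ⟨_, hs₁', hr6, hr7, hr5, hr4, hdeg', by omega, by omega, ?_, fun a x hax => ?_⟩
      · have hwu : w ∈ lostNbrs H u v := by
          rw [mem_lostNbrs]
          refine ⟨hw, ?_⟩
          by_contra! hcon
          refine hne' ?_
          have : w ∉ nbrs (H.deleteEdges {s(v, w)}) u := by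
            simp [SimpleGraph.deleteEdges_adj, hcon.2]
          simp [posE, hr7, hr8, hs₁.size, hs₁.pos_zero u w this, Fin.val_inj, hcon.1]
        have := card_lostNbrs_deleteEdges hwu
        omega
      · exact h.isolated a x (SimpleGraph.deleteEdges_le _ hax)
    · simp only [posE, RamExpr.eval_add, RamExpr.eval_eq, RamExpr.eval_reg, hr8, hr7,
        RamExpr.eval_load, RamExpr.eval_mul, hs₁.size, Nat.add_eq_zero_iff] at h0'
      have hwu : w ≠ u := by rintro heq; rw [heq] at h0'; simp at h0'
      have hnot : ¬ (H.deleteEdges {s(v, w)}).Adj u w := fun hadj =>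
        hs₁.pos_ne_zero_iff.2 (mem_nbrs.2 hadj) h0'.2
      refine .addEdge hs₁ hW hr7 hr8 hwu.symm hnot fun s₂ hs₂ hss => ?_
      have hE' := ncard_edgeSet_sup_edge hwu.symm hnot
      have hlost := card_lostNbrs_move huv hw hwu
      refine ⟨_, hs₁'.addEdge (hX w hwu (h.le hw)) hs₂ hss, ?_, ?_, ?_, ?_, ?_, ?_, by omega, by omega, ?_⟩
      · rw [hss.1, hr6]
      · rw [hss.1, hr7]
      · rw [hss.1, hr5]
      · rw [hss.1, hr4]
      · convert hdeg' using 2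
        ext x
        simp [SimpleGraph.edge_adj, huv.symm, hvw]
      · rw [hss.1]; omega
      · intro a x hax
        rw [SimpleGraph.sup_adj, SimpleGraph.edge_adj] at hax
        rcases hax with hax | ⟨⟨rfl, rfl⟩ | ⟨rfl, rfl⟩, -⟩
        · exact h.isolated a x (SimpleGraph.deleteEdges_le _ hax)
        · exact Or.inl hu
        · exact h.isolated _ _ hw.symm
  · refine .skip ⟨H, h.toRepresents, hv₆, hu₇, h.running, h.cursor, ?_, by omega, h.edges_le, h.le_edges,
      h.isolated⟩
    simp [degE, hv₆, hdeg] at h0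
    simp [h0]

/-! ### Search for a neighbour with few common neighbours -/

/-- The number of common neighbours of the vertex `v` in register `6` and its `i`-th neighbour, if
the degree of `v` is at most `b`. -/
def commonE (b i : ℕ) : RamExpr :=
  .sum (fun j => .lt (.const j) (degE (.reg 6)) *
    .lt (.const 0) (posE (nbrE (.const i) (.reg 6)) (nbrE (.const j) (.reg 6)))) b

/-- Whether the vertex in register `6` has an `i`-th neighbour, with fewer than `q` common
neighbours. -/
def lightE (q b i : ℕ) : RamExpr :=
  .lt (.const i) (degE (.reg 6)) * .lt (commonE b i) (.const q)

/-- Finding a neighbour `u` of the vertex in register `6`, among the first `k`, with fewer than `q`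
common neighbours. Register `7` receives `u + 1`, or `0` if there is none. -/
def search (q b : ℕ) : ℕ → RamProg
  | 0 => .set 7 (.const 0)
  | k + 1 => .seq (search q b k)
      (.ite (lightE q b k) (.set 7 (nbrE (.const k) (.reg 6) + .const 1)) .skip)

/-- The common neighbours of two vertices. -/
noncomputable def commonNbrs {n : ℕ} (H : SimpleGraph (Fin n)) (u v : Fin n) :
    Finset (Fin n) := by
  classical exact (nbrs H v).filter (H.Adj u)

section Search

variable {n W b q : ℕ} {s : RamState} {H : SimpleGraph (Fin n)} {v : Fin n}

/-- The index `i` may exceed `n` when `n` is small compared with `b`; this is why a word bound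
besides `hW` is needed. -/
theorem fits_nbrE (h : Stores n s (nbrs H)) (hW : (n + 2) * (n + 2) ≤ W) (hb : b * n + n < W)
    (hv : s.reg 6 = v) {i : ℕ} (hi : i < b) :
    (nbrE (.const i) (.reg 6)).Fits W s ∧ (nbrE (.const i) (.reg 6)).eval s = h.nbr i v := by
  have hvl := v.2
  have : n + 2 < W := by nlinarith [v.pos]
  have h₁ : i * n + n ≤ b * n := by
    have : (i + 1) * n ≤ b * n := Nat.mul_le_mul_right _ hi
    rwa [Nat.add_mul, one_mul] at this
  have h₂ : i ≤ i * n := Nat.le_mul_of_pos_right _ v.pos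
  have := h.label (i * n + v)
  constructor
  · simp [nbrE, hv, h.size]; omega
  · simp [nbrE, hv, h.size, Stores.nbr]

theorem fits_commonE (h : Stores n s (nbrs H)) (hW : (n + 2) * (n + 2) ≤ W) (hb : b * n + n < W)
    (hv : s.reg 6 = v) {i : ℕ} (hi : i < b) : (commonE b i).Fits W s := by
  have hvl := v.2
  have hn : n + 2 < W := by nlinarith [v.pos]
  have hbn : b ≤ b * n := Nat.le_mul_of_pos_right _ v.pos
  refine (RamExpr.fits_sum (by omega) fun j hj => ?_).1
  obtain ⟨f₁, e₁⟩ := fits_nbrE h hW hb hv hi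
  obtain ⟨f₂, e₂⟩ := fits_nbrE h hW hb hv hj
  have hd := h.deg v
  have hc := h.card_le v
  have hl₁ := (h.nbr i v).2
  have hl₂ := (h.nbr j v).2
  have hp := h.pos_le (h.nbr i v) (h.nbr j v)
  have ha := mul_add_lt_of_sq_le hW hl₁.le hl₂.le
  have h1 : 1 < W := by omega
  simp only [degE, posE, RamExpr.fits_mul, RamExpr.fits_lt h1, RamExpr.fits_load, RamExpr.fits_add,
    RamExpr.fits_const, RamExpr.fits_reg, RamExpr.eval_mul, RamExpr.eval_lt, RamExpr.eval_const,
    RamExpr.eval_load, RamExpr.eval_add, RamExpr.eval_reg, e₁, e₂, hv, hd, h.size, f₁, f₂]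
  constructor
  · refine ⟨⟨by omega, by omega, by omega⟩, ⟨by omega, ⟨⟨trivial, by omega, by omega⟩, trivial,
      ha⟩, by omega⟩, ?_⟩
    split_ifs <;> omega
  · split_ifs <;> simp

/-- The neighbour list has no repetitions, so counting positions amounts to counting vertices;
positions beyond the degree contribute 0. -/
theorem eval_commonE (h : Stores n s (nbrs H)) (hW : (n + 2) * (n + 2) ≤ W) (hb : b * n + n < W)
    (hv : s.reg 6 = v) {i : ℕ} (hi : i < b) (hvb : (nbrs H v).card ≤ b) :
    (commonE b i).eval s = (commonNbrs H (h.nbr i v) v).card := by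
  classical
  obtain ⟨f₁, e₁⟩ := fits_nbrE h hW hb hv hi
  rw [commonE, RamExpr.eval_sum]
  have hstep : ∀ j ∈ Finset.range b,
      ((RamExpr.lt (.const j) (degE (.reg 6)) * RamExpr.lt (.const 0)
        (posE (nbrE (.const i) (.reg 6)) (nbrE (.const j) (.reg 6)))).eval s) =
      if j < (nbrs H v).card ∧ H.Adj (h.nbr i v) (h.nbr j v) then 1 else 0 := by
    intro j hj
    obtain ⟨f₂, e₂⟩ := fits_nbrE h hW hb hv (Finset.mem_range.1 hj)
    have := h.pos_ne_zero_iff (a := h.nbr i v) (b := h.nbr j v)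
    rw [mem_nbrs] at this
    simp only [degE, posE, RamExpr.eval_mul, RamExpr.eval_lt, RamExpr.eval_const,
      RamExpr.eval_load, RamExpr.eval_add, RamExpr.eval_reg, e₁, e₂, hv, h.deg, h.size,
      Nat.pos_iff_ne_zero, this]
    by_cases h1 : j < (nbrs H v).card <;> simp [h1]
  rw [Finset.sum_congr rfl hstep, Finset.sum_boole, Nat.cast_id]
  have himg : commonNbrs H (h.nbr i v) v =
      ((Finset.range (nbrs H v).card).filter fun j => H.Adj (h.nbr i v) (h.nbr j v)).image
        fun j => h.nbr j v := by
    rw [← Finset.filter_image (s := Finset.range (nbrs H v).card) (f := fun j => h.nbr j v)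
      (p := fun x => H.Adj (h.nbr i v) x), h.image_nbr, commonNbrs]
  rw [himg, Finset.card_image_of_injOn]
  · congr 1
    ext j
    simp only [Finset.mem_filter, Finset.mem_range]
    constructor
    · rintro ⟨-, h⟩; exact h
    · rintro ⟨h₁, h₂⟩; exact ⟨by omega, h₁, h₂⟩
  · exact (h.nbr_injOn v).mono (by intro j; simp +contextual)

theorem Run.search (h : Stores n s (nbrs H)) (hW : (n + 2) * (n + 2) ≤ W) (hb : b * n + n < W)
    (hq : q < W) (hv : s.reg 6 = v) (hvb : (nbrs H v).card ≤ b) {k : ℕ} (hk : k ≤ b) :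
    Run W (search q b k) s fun s' => ∃ x, s' = s.setReg 7 x ∧
      (x = 0 → ∀ i < k, i < (nbrs H v).card → q ≤ (commonNbrs H (h.nbr i v) v).card) ∧
      (x ≠ 0 → ∃ u, H.Adj v u ∧ (commonNbrs H u v).card < q ∧ x = u + 1) := by
  have hvl := v.2
  have hn : n + 2 < W := by nlinarith [v.pos]
  have hbn : b ≤ b * n := Nat.le_mul_of_pos_right _ v.pos
  have hc := h.card_le v
  induction k with
  | zero =>
    exact .set (by simp; omega) ⟨0, rfl, by simp, by simp⟩
  | succ k ih =>
    refine .seq ((ih (by omega)).mono ?_)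
    rintro _ ⟨x, rfl, hx₀, hx₁⟩
    have h' : Stores n (s.setReg 7 x) (nbrs H) := h.congr (by simp) (by simp) (by simp) (by simp)
    have hv' : (s.setReg 7 x).reg 6 = v := by simp [hv]
    have hnbr : h'.nbr k v = h.nbr k v := rfl
    obtain ⟨f₁, e₁⟩ := fits_nbrE h' hW hb hv' (show k < b by omega)
    have hf := fits_commonE h' hW hb hv' (show k < b by omega)
    have he := eval_commonE h' hW hb hv' (show k < b by omega) hvb
    have h1 : 1 < W := by omega
    have hd := h.deg v
    have hl := (h.nbr k v).2
    rw [hnbr] at he e₁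
    refine .ite ?_ (fun hne => ?_) fun h0 => ?_
    · simp only [lightE, degE, RamExpr.fits_mul, RamExpr.fits_lt h1, hf, RamExpr.fits_const,
        RamExpr.fits_load, RamExpr.fits_reg, RamExpr.eval_reg, RamExpr.eval_lt, hv',
        RamState.mem_setReg, hd]
      refine ⟨⟨by omega, by omega, by omega⟩, ⟨trivial, hq⟩, ?_⟩
      split_ifs <;> omega
    · simp only [lightE, degE, RamExpr.eval_mul, RamExpr.eval_lt, RamExpr.eval_const, he,
        RamExpr.eval_load, RamExpr.eval_reg, hv', RamState.mem_setReg, hd] at hne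
      have hk₁ : k < (nbrs H v).card := by by_contra hcon; simp [hcon] at hne
      have hk₂ : (commonNbrs H (h.nbr k v) v).card < q := by by_contra hcon; simp [hcon] at hne
      refine .set ?_ ⟨h.nbr k v + 1, ?_, by simp, fun _ => ⟨h.nbr k v, ?_, hk₂, rfl⟩⟩
      · rw [RamExpr.fits_add]
        exact ⟨f₁, by simp; omega, by rw [e₁, RamExpr.eval_const]; omega⟩
      · rw [RamExpr.eval_add, e₁]
        simp [RamState.setReg]
      · exact mem_nbrs.1 (h.nbr_mem hk₁)
    · refine .skip ⟨x, rfl, fun hx i hi hi' => ?_, hx₁⟩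
      rcases Nat.lt_succ_iff_lt_or_eq.1 hi with hi | rfl
      · exact hx₀ hx i hi hi'
      · simp only [lightE, degE, RamExpr.eval_mul, RamExpr.eval_lt, RamExpr.eval_const, he,
          RamExpr.eval_load, RamExpr.eval_reg, hv', RamState.mem_setReg, hd] at h0
        by_contra! hcon
        simp [hi', hcon] at h0

end Search

/-- Contracting the vertex in register `6` into the vertex `u`, where register `7` holds `u + 1`. -/
def contractVertex (d : ℕ) : RamProg :=
  .seq (.set 7 (.reg 7 - .const 1)) (.seq (emit 2 (.reg 7) (.reg 6))
    (.seq (.store 8 (.reg 6) (.const 1)) (moveEdge.repeat d)))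

/-- Deleting the isolated vertex in register `6`. -/
def deleteIsolated : RamProg :=
  .seq (emit 0 (.reg 6) (.const 0)) (.store 8 (.reg 6) (.const 1))

/-- Contraction and deletion alike remove exactly the label `v`. An absent vertex need not be on the
stack, so the exemption of `v` in `T` can be given up. -/
theorem Represents.step {n b : ℕ} {G : SimpleGraph (Fin n)} {T T' : Set (Fin n)}
    {s s' s'' : RamState} {H : SimpleGraph (Fin n)} {X : LabelledGraph (Fin n)}
    {ops : List (MinorOp (Fin n))} (h : Represents G b T s H X ops) {op : MinorOp (Fin n)}
    {v : Fin n} (hv : v ∈ X.verts) (hlegal : op.Legal X)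
    (hverts : (op.apply X).verts = X.verts.erase v)
    (hle : H ≤ (op.apply X).graph) (hT : ∀ a, a ∈ T → a = v ∨ a ∈ T')
    (hout : s'.Outputs (ops ++ [op])) (hs : OnlyOutput s s') (hs' : s'' = s'.setMem 8 v 1) :
    Represents G b T' s'' H (op.apply X) (ops ++ [op]) := by
  subst hs'
  refine ⟨?_, h.reaches.snoc hlegal, hout.congr ?_ ?_ ?_ ?_, hle, fun a => ?_, fun i => ?_,
    fun a ha haT hab => ?_, fun a ha => ?_, ?_, ?_⟩
  · exact (h.stores.of_onlyOutput hs).congr (by simp) (by simp) (by simp) (by simp)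
  any_goals simp
  · simp only [hverts, hs.2 8 a (by decide) (by decide) (by decide), h.absent, Finset.mem_erase]
    by_cases hav : a = v <;> simp [hav, Fin.val_inj]
  · rw [hs.2 _ _ (by decide) (by decide) (by decide)]; exact h.stack_lt i
  · rw [hverts, Finset.mem_erase] at ha
    obtain ⟨i, hi, hi'⟩ := h.stack a ha.2 (fun haT' => (hT a haT').elim ha.1 haT) hab
    exact ⟨i, by simpa [hs.1] using hi,
      by rw [hs.2 _ _ (by decide) (by decide) (by decide), hi']⟩
  · rw [hverts, Finset.mem_erase] at ha
    simpa [hs.1] using h.first a ha.2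
  · simpa [hs.1] using h.first_le
  · have := h.output_le
    have := Finset.card_erase_add_one hv
    rw [hverts, hs.1, if_pos rfl]
    omega

/-- The invariant of the main loop as long as no dense neighbourhood is found. -/
structure Progress {n : ℕ} (G : SimpleGraph (Fin n)) (q m : ℕ) (s : RamState)
    (H : SimpleGraph (Fin n)) (X : LabelledGraph (Fin n)) (ops : List (MinorOp (Fin n))) : Prop
    extends Represents G (2 * q + 1) ∅ s H X ops where
  running : s.reg 5 = 0
  edges : q * X.verts.card ≤ H.edgeSet.ncard
  nonempty : X.verts.Nonempty
  isolated : ∀ a x, H.Adj a x → a ∈ X.verts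
  -- A dropped edge releases 3 and causes 2 pushes. A contracted vertex releases `4 * q + 2`, which
  -- pays for two pushes in each of at most `2 * q + 1` moves. Pops and cursor moves release 1.
  potential : s.reg 3 + 3 * H.edgeSet.ncard + (4 * q + 2) * X.verts.card + (n - s.reg 4) ≤ m

/-- The vertex `v` has a dense neighbourhood of bounded size. -/
structure Found {n : ℕ} (G : SimpleGraph (Fin n)) (q : ℕ) (s : RamState)
    (H : SimpleGraph (Fin n)) (X : LabelledGraph (Fin n)) (ops : List (MinorOp (Fin n)))
    (v : Fin n) : Prop extends Represents G (2 * q + 1) {v} s H X ops where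
  halted : s.reg 5 = 1
  center : s.reg 6 = v
  mem : v ∈ X.verts
  isolated : ∀ a x, H.Adj a x → a ∈ X.verts
  degree_pos : 0 < (nbrs H v).card
  degree_le : (nbrs H v).card ≤ 2 * q + 1
  dense : ∀ u, H.Adj v u → q ≤ (commonNbrs H u v).card

/-- The invariant of the main loop. -/
def MainInv {n : ℕ} (G : SimpleGraph (Fin n)) (q M m : ℕ) (s : RamState) : Prop :=
  m ≤ M ∧ ((∃ H X ops, Progress G q m s H X ops) ∨ ∃ H X ops v, Found G q s H X ops v)

/-- The number of edges of `H` may fall by up to `q`, matching the vertex that disappears. The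
potential does not rise, so the preceding pop makes the progress. -/
theorem Run.contractVertex {n W q M m : ℕ} {G : SimpleGraph (Fin n)} {s : RamState}
    {H : SimpleGraph (Fin n)} {X : LabelledGraph (Fin n)} {ops : List (MinorOp (Fin n))}
    {u v : Fin n} (hW : (n + 2) * (n + 2) ≤ W) (hM : M + 4 * q + 9 ≤ W) (hm : m < M)
    (h : Represents G (2 * q + 1) {v} s H X ops) (h5 : s.reg 5 = 0) (hv : s.reg 6 = v)
    (hu : s.reg 7 = u + 1) (hmem : v ∈ X.verts) (huv : H.Adj v u)
    (hd : (nbrs H v).card ≤ 2 * q + 1) (hlight : (commonNbrs H u v).card < q)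
    (hedges : q * X.verts.card ≤ H.edgeSet.ncard) (hiso : ∀ a x, H.Adj a x → a ∈ X.verts)
    (hpot : s.reg 3 + 3 * H.edgeSet.ncard + (4 * q + 2) * X.verts.card + (n - s.reg 4) ≤ m) :
    Run W (contractVertex (2 * q + 1)) s (MainInv G q M m) := by
  have hn : n + 2 < W := by nlinarith [u.pos]
  have hvl := v.2
  have hul := u.2
  have hne := huv.ne
  have hout := h.output_le
  have hcard := Finset.card_erase_add_one hmem
  have hleg : (MinorOp.contract u v).Legal X := ⟨hiso u v huv.symm, hmem, (h.le huv).symm⟩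
  refine .seq (.set ?_ (.seq (.emit (x := u) (y := v) (op := .contract u v) (h.outputs.congr ?_ ?_ ?_ ?_)
    ?_ ?_ (fun s' hr _ => ?_) (fun s' hr _ => ?_) ?_ fun s₁ hout₁ hs₁ =>
      .seq (.store ?_ ?_ ?_))))
  any_goals simp [MinorOp.EncodedBy]
  any_goals omega
  · simp [hr, hu]; omega
  · simp [hr, hv]; omega
  · simp [hs₁.1, hv]; omega
  have hset : Represents G (2 * q + 1) {v} (s.setReg 7 ((RamExpr.reg 7 - .const 1).eval s)) H X ops :=
    h.congr (by simp) (by simp +contextual)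
  set s₂ := s₁.setMem 8 (s₁.reg 6) 1 with hs₂
  have hr2 : ∀ r, s₂.reg r = s₁.reg r := fun r => by simp [hs₂]
  have hv₁ : s₁.reg 6 = v := by simp [hs₁.1, hv]
  have hstep := hset.step (T' := ∅) hmem hleg rfl (h.le.trans le_sup_left) (by simp) hout₁ hs₁
    (s'' := s₂) (by rw [hs₂, hv₁])
  have hverts : (MinorOp.apply X (.contract u v)).verts.card + 1 = X.verts.card := hcard
  -- At most `q - 1` common neighbours, and one more for the edge `uv` itself.
  have hlost : (lostNbrs H u v).card ≤ q := by
    have : lostNbrs H u v ⊆ insert u (commonNbrs H u v) := by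
      intro w hw
      rw [mem_lostNbrs] at hw
      simp [commonNbrs]
      tauto
    exact (Finset.card_le_card this).trans ((Finset.card_insert_le _ _).trans hlight)
  have hmul : q * X.verts.card = q * (MinorOp.apply X (.contract u v)).verts.card + q := by
    rw [← hverts]; ring
  have hmul' : (4 * q + 2) * X.verts.card =
      (4 * q + 2) * (MinorOp.apply X (.contract u v)).verts.card + (4 * q + 2) := by
    rw [← hverts]; ring
  have hstart : Contracting G (2 * q + 1) q (s.reg 3 + 2 * (2 * q + 1)) H.edgeSet.ncard
      (s.reg 4) (2 * q + 1) ∅ u v s₂ H (MinorOp.apply X (.contract u v))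
      (ops ++ [.contract u v]) := by
    refine ⟨hstep, ?_, ?_, ?_, ?_, hd, ?_, le_rfl, by omega, fun a x hax => ?_⟩
    · rw [hr2, hv₁]
    · simp [hr2, hs₁.1, hu]
    · simp [hr2, hs₁.1, h5]
    · simp [hr2, hs₁.1]
    · simp [hr2, hs₁.1]
    · by_cases hav : a = v
      · exact Or.inr hav
      · exact Or.inl (Finset.mem_erase.2 ⟨hav, hiso a x hax⟩)
  have humem : u ∈ (MinorOp.apply X (.contract u v)).verts :=
    Finset.mem_erase.2 ⟨hne.symm, hleg.1⟩
  have hX' : ∀ w, w ≠ u → (MinorOp.apply X (.contract u v)).graph.Adj v w →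
      (MinorOp.apply X (.contract u v)).graph.Adj u w := by
    intro w hwu hvw
    simp only [MinorOp.apply, SimpleGraph.sup_adj, SimpleGraph.fromRel_adj] at hvw ⊢
    rcases hvw with hvw | ⟨-, ⟨h, -⟩ | ⟨h, -⟩⟩
    · exact Or.inr ⟨hwu.symm, Or.inl ⟨trivial, hvw⟩⟩
    · exact absurd h hne
    · exact absurd h hwu
  refine (Run.repeat (p := _root_.moveEdge) (I := fun d s' => ∃ H',
    Contracting G (2 * q + 1) q (s.reg 3 + 2 * (2 * q + 1)) H.edgeSet.ncard (s.reg 4) d ∅ u v s' H'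
      (MinorOp.apply X (.contract u v)) (ops ++ [.contract u v])) ?_ (2 * q + 1)
      ⟨H, hstart⟩).mono ?_
  · rintro d s' ⟨H', h'⟩
    exact .moveEdge hW (by omega) hne.symm humem hX' h'
  · rintro s' ⟨H', h'⟩
    have h₁ := h'.edges_le
    have h₂ := h'.le_edges
    have h₃ := h'.stack_le
    have h₄ := h'.cursor
    refine ⟨hm.le, Or.inl ⟨H', _, _, h'.toRepresents, h'.running, by omega, ⟨u, humem⟩,
      fun a x hax => ?_, ?_⟩⟩
    -- After `2 * q + 1` moves the degree of `v` is at most 0, so no edge is left at the contracted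
    -- vertex.
    · refine (h'.isolated a x hax).resolve_right ?_
      rintro rfl
      have hx := h'.degree_le
      rw [Nat.le_zero, Finset.card_eq_zero] at hx
      simpa [hx] using mem_nbrs.2 hax
    · omega

theorem Run.deleteIsolated {n W q M m : ℕ} {G : SimpleGraph (Fin n)} {s : RamState}
    {H : SimpleGraph (Fin n)} {X : LabelledGraph (Fin n)} {ops : List (MinorOp (Fin n))}
    {v : Fin n} (hq : 0 < q) (hW : (n + 2) * (n + 2) ≤ W) (hm : m < M)
    (h : Represents G (2 * q + 1) {v} s H X ops) (h5 : s.reg 5 = 0) (hv : s.reg 6 = v)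
    (hmem : v ∈ X.verts) (hd : (nbrs H v).card = 0)
    (hedges : q * X.verts.card ≤ H.edgeSet.ncard) (hiso : ∀ a x, H.Adj a x → a ∈ X.verts)
    (hpot : s.reg 3 + 3 * H.edgeSet.ncard + (4 * q + 2) * X.verts.card + (n - s.reg 4) ≤ m) :
    Run W deleteIsolated s (MainInv G q M m) := by
  have hvl := v.2
  have hn : n + 2 < W := by nlinarith
  have hout := h.output_le
  have hcard := Finset.card_erase_add_one hmem
  have hv0 : ∀ x, ¬ H.Adj v x := fun x hx => by
    rw [Finset.card_eq_zero] at hd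
    simpa [hd] using mem_nbrs.2 hx
  refine .seq (.emit (x := v) (y := 0) (op := .deleteVertex v) h.outputs ?_ ?_
    (fun s' hr _ => ?_) (fun s' hr _ => ?_) ?_ fun s₁ hout₁ hs₁ => .store ?_ ?_ ?_)
  any_goals simp [MinorOp.EncodedBy]
  any_goals omega
  · simp [hr, hv]; omega
  · simp [hs₁.1, hv]; omega
  have hv₁ : s₁.reg 6 = v := by simp [hs₁.1, hv]
  have hstep := h.step (T' := ∅) (op := .deleteVertex v) hmem hmem rfl h.le (by simp) hout₁ hs₁
    (s'' := s₁.setMem 8 (s₁.reg 6) 1) (by rw [hv₁])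
  have hverts : (MinorOp.apply X (.deleteVertex v)).verts.card + 1 = X.verts.card := hcard
  have hmul : q * X.verts.card = q * (MinorOp.apply X (.deleteVertex v)).verts.card + q := by
    rw [← hverts]; ring
  have hmul' : (4 * q + 2) * X.verts.card =
      (4 * q + 2) * (MinorOp.apply X (.deleteVertex v)).verts.card + (4 * q + 2) := by
    rw [← hverts]; ring
  refine ⟨hm.le, Or.inl ⟨H, _, _, hstep, ?_, by omega, ?_, fun a x hax => ?_, ?_⟩⟩
  · simp [hs₁.1, h5]
  -- Since `q > 0`, the edge bound leaves an edge, and its ends differ from the isolated vertex.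
  · have hpos : 0 < H.edgeSet.ncard := by omega
    rw [Set.ncard_pos] at hpos
    obtain ⟨e, he⟩ := hpos
    induction e with
    | _ a b =>
      refine ⟨a, Finset.mem_erase.2 ⟨?_, hiso a b he⟩⟩
      rintro rfl
      exact hv0 b he
  · refine Finset.mem_erase.2 ⟨?_, hiso a x hax⟩
    rintro rfl
    exact hv0 x hax
  · simp [hs₁.1]; omega

/-- Treating the vertex on top of the stack: it is contracted into a neighbour with few common
neighbours, or deleted if it is isolated. -/
def popVertex (q : ℕ) : RamProg :=
  .seq (.set 3 (.reg 3 - .const 1)) (.seq (.set 6 (.load 9 (.reg 3)))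
    (.ite (.lt (.load 8 (.reg 6)) (.const 1) * .lt (degE (.reg 6)) (.const (2 * q + 2)))
      (.seq (search q (2 * q + 1) (2 * q + 1))
        (.ite (.reg 7) (contractVertex (2 * q + 1))
          (.ite (degE (.reg 6)) (.set 5 (.const 1)) deleteIsolated)))
      .skip))

/-- Removing an edge at the first vertex present, when all degrees are large. -/
def thinOut : RamProg :=
  .ite (.load 8 (.reg 4)) (.set 4 (.reg 4 + .const 1))
    (.seq (.set 6 (.reg 4)) (.seq (.set 8 (nbrE (.const 0) (.reg 6))) removeEdge))

/-- The main loop. -/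
def mainLoop (q : ℕ) : RamProg :=
  .loop (.lt (.reg 5) (.const 1)) (.ite (.reg 3) (popVertex q) thinOut)

/-- The pop alone lowers the potential by 1. Meanwhile the popped vertex is exempt from the stack
condition, until it is removed, its neighbourhood is found dense, or its entry proves outdated. -/
theorem Run.popVertex {n W q M m : ℕ} {G : SimpleGraph (Fin n)} {s : RamState}
    {H : SimpleGraph (Fin n)} {X : LabelledGraph (Fin n)} {ops : List (MinorOp (Fin n))}
    (hq : 0 < q) (hW : (n + 2) * (n + 2) ≤ W) (hb : (2 * q + 1) * n + n < W)
    (hM : M + 4 * q + 9 ≤ W) (hm : m ≤ M) (h : Progress G q m s H X ops) (h3 : s.reg 3 ≠ 0) :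
    Run W (popVertex q) s fun s' => ∃ m' < m, MainInv G q M m' s' := by
  have hpot := h.potential
  have hvlt := h.stack_lt (s.reg 3 - 1)
  obtain ⟨v, hv⟩ : ∃ v : Fin n, s.mem 9 (s.reg 3 - 1) = v := ⟨⟨_, hvlt⟩, rfl⟩
  have hvl := v.2
  have hn : n + 2 < W := by nlinarith
  have habs : s.mem 8 v ≤ 1 := by rw [h.absent]; split <;> omega
  have hdeg := h.stores.deg v
  have hcard := h.stores.card_le v
  refine .seq (.set ?_ (.seq (.set ?_ ?_)))
  · simp; omega
  · simp [hv]; omega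
  set s₁ := (s.setReg 3 ((RamExpr.reg 3 - .const 1).eval s)).setReg 6
    ((RamExpr.load 9 (.reg 3)).eval (s.setReg 3 ((RamExpr.reg 3 - .const 1).eval s))) with hs₁
  have hmem₁ : s₁.mem = s.mem := rfl
  have hr : ∀ r, r ≠ 3 → r ≠ 6 → s₁.reg r = s.reg r := by
    intro r h3 h6; simp [hs₁, h3, h6]
  have hr3 : s₁.reg 3 = s.reg 3 - 1 := by simp [hs₁]
  have hr6 : s₁.reg 6 = v := by simp [hs₁, hv]
  have hr5 : s₁.reg 5 = 0 := (hr 5 (by decide) (by decide)).trans h.running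
  have hr4 : s₁.reg 4 = s.reg 4 := hr 4 (by decide) (by decide)
  have hrep : Represents G (2 * q + 1) {v} s₁ H X ops := by
    refine ⟨h.stores.congr (hr _ (by decide) (by decide)) (by simp [hmem₁]) (by simp [hmem₁])
      (by simp [hmem₁]), h.reaches, h.outputs.congr (hr _ (by decide) (by decide)) (by simp [hmem₁])
      (by simp [hmem₁]) (by simp [hmem₁]), h.le, by simpa [hmem₁] using h.absent,
      by simpa [hmem₁] using h.stack_lt, fun a ha hav had => ?_, by simpa [hr4] using h.first,
      by simpa [hr4] using h.first_le, ?_⟩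
    · obtain ⟨i, hi, hi'⟩ := h.stack a ha (by simp) had
      refine ⟨i, ?_, hi'⟩
      have : i ≠ s.reg 3 - 1 := by
        rintro rfl
        exact hav (Fin.ext (hi'.symm.trans hv))
      omega
    · rw [hr 0 (by decide) (by decide)]; exact h.output_le
  refine .ite ?_ (fun hne => ?_) fun h0 => ?_
  · simp only [degE, RamExpr.fits_mul, RamExpr.fits_lt (show 1 < W by omega), RamExpr.fits_load,
      RamExpr.fits_reg, RamExpr.fits_const, RamExpr.eval_reg, RamExpr.eval_lt, hr6, hmem₁, hdeg]
    refine ⟨⟨⟨by omega, by omega⟩, by omega⟩, ⟨⟨by omega, by omega⟩, by omega⟩, ?_⟩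
    split_ifs <;> omega
  · simp only [degE, RamExpr.eval_mul, RamExpr.eval_lt, RamExpr.eval_load, RamExpr.eval_reg, hr6,
      RamExpr.eval_const, hmem₁, hdeg, h.absent] at hne
    have hvm : v ∈ X.verts := by by_contra hcon; simp [hcon] at hne
    have hvd : (nbrs H v).card ≤ 2 * q + 1 := by
      by_contra! hcon
      simp [show ¬ (nbrs H v).card < 2 * q + 2 by omega] at hne
    refine .seq ((Run.search hrep.stores hW hb (by omega) hr6 hvd le_rfl).mono ?_)
    rintro _ ⟨x, rfl, hx₀, hx₁⟩
    have hrep' : Represents G (2 * q + 1) {v} (s₁.setReg 7 x) H X ops :=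
      hrep.congr (by simp) (by simp +contextual)
    have hxW : x ≤ n := by
      by_cases hx : x = 0
      · omega
      · obtain ⟨u, -, -, rfl⟩ := hx₁ hx
        exact u.2
    refine .ite (by simp; omega) (fun hx => ?_) fun hx => ?_
    · obtain ⟨u, hu, hlight, rfl⟩ := hx₁ (by simpa using hx)
      clear hx₁
      refine (Run.contractVertex (m := m - 1) hW hM (by omega) hrep' (by simp [hr5])
        (by simp [hr6]) (by simp) hvm hu hvd hlight h.edges h.isolated ?_).mono
        fun s' hs' => ⟨m - 1, by omega, hs'⟩
      simp [hr3, hr4]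
      omega
    · have hx0 : x = 0 := by simpa using hx
      clear hx₁
      refine .ite ?_ (fun hd => ?_) fun hd => ?_
      · simp [degE, hr6, hmem₁, hdeg]; omega
      · simp only [degE, RamExpr.eval_load, RamExpr.eval_reg, RamState.mem_setReg,
          RamState.reg_setReg, hmem₁] at hd
        simp only [show (6 : ℕ) ≠ 7 by decide, if_false, hr6, hdeg] at hd
        refine .set (by simp; omega) ⟨m - 1, by omega, by omega, Or.inr ⟨H, X, ops, v,
          hrep'.congr (by simp) (by simp +contextual), by simp, by simp [hr6], hvm, h.isolated,
          by omega, hvd, fun u hu => ?_⟩⟩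
        obtain ⟨i, hi, -, hi'⟩ := hrep.stores.pos v u (mem_nbrs.2 hu)
        have hnb : hrep.stores.nbr i v = u := Fin.ext hi'
        have := hx₀ hx0 i (by omega) hi
        rwa [hnb] at this
      · simp only [degE, RamExpr.eval_load, RamExpr.eval_reg, RamState.mem_setReg,
          RamState.reg_setReg, hmem₁] at hd
        simp only [show (6 : ℕ) ≠ 7 by decide, if_false, hr6, hdeg] at hd
        refine (Run.deleteIsolated (m := m - 1) hq hW (by omega) hrep' (by simp [hr5])
          (by simp [hr6]) hvm hd h.edges h.isolated ?_).mono
          fun s' hs' => ⟨m - 1, by omega, hs'⟩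
        simp [hr3, hr4]
        omega
  · simp only [degE, RamExpr.eval_mul, RamExpr.eval_lt, RamExpr.eval_load, RamExpr.eval_reg, hr6,
      RamExpr.eval_const, hmem₁, hdeg, h.absent] at h0
    refine .skip ⟨m - 1, by omega, by omega, Or.inl ⟨H, X, ops,
      { hrep with stack := fun a ha _ had => ?_ }, hr5, h.edges, h.nonempty, h.isolated, ?_⟩⟩
    -- The test failed, so the popped vertex is absent or of large degree and the exemption is not
    -- needed.
    · refine hrep.stack a ha ?_ had
      rintro rfl
      simp [ha, show (nbrs H a).card < 2 * q + 2 by omega] at h0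
    · rw [hr3, hr4]; omega

/-- With an empty stack all degrees are at least `2 * q + 2`, so one edge is to spare. The cursor
passes over absent labels only, and labels never return, so it stays below `n` as long as a vertex
is left. -/
theorem Run.thinOut {n W q M m : ℕ} {G : SimpleGraph (Fin n)} {s : RamState}
    {H : SimpleGraph (Fin n)} {X : LabelledGraph (Fin n)} {ops : List (MinorOp (Fin n))}
    (hW : (n + 2) * (n + 2) ≤ W) (hM : M + 4 * q + 9 ≤ W) (hm : m ≤ M)
    (h : Progress G q m s H X ops) (h3 : s.reg 3 = 0) :
    Run W thinOut s fun s' => ∃ m' < m, MainInv G q M m' s' := by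
  have hpot := h.potential
  obtain ⟨a₀, ha₀⟩ := h.nonempty
  have hcur : s.reg 4 < n := (h.first a₀ ha₀).trans_lt a₀.2
  obtain ⟨v, hv⟩ : ∃ v : Fin n, s.reg 4 = v := ⟨⟨_, hcur⟩, rfl⟩
  have hvl := v.2
  have hn : n + 2 < W := by nlinarith
  have habs : s.mem 8 v ≤ 1 := by rw [h.absent]; split <;> omega
  refine .ite ?_ (fun hne => ?_) fun h0 => ?_
  · simp [hv]; omega
  · simp only [RamExpr.eval_load, RamExpr.eval_reg, hv, h.absent] at hne
    have hvm : v ∉ X.verts := by intro hcon; simp [hcon] at hne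
    refine .set (by simp; omega) ⟨m - 1, by omega, by omega, Or.inl ⟨H, X, ops, ⟨?_, h.reaches, ?_,
      h.le, h.absent, h.stack_lt, ?_, fun a ha => ?_, ?_, ?_⟩, ?_, h.edges, h.nonempty, h.isolated,
      ?_⟩⟩
    · exact h.stores.congr (by simp) (by simp) (by simp) (by simp)
    · exact h.outputs.congr (by simp) (by simp) (by simp) (by simp)
    · simpa using h.stack
    · have := h.first a ha
      have : v ≠ a := by rintro rfl; exact hvm ha
      have := Fin.val_ne_of_ne this
      simp; omega
    · simp; omega
    · simpa using h.output_le
    · simpa using h.running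
    · simp; omega
  · simp only [RamExpr.eval_load, RamExpr.eval_reg, hv, h.absent] at h0
    have hvm : v ∈ X.verts := by by_contra hcon; simp [hcon] at h0
    have hlarge : ∀ a ∈ X.verts, 2 * q + 2 ≤ (nbrs H a).card := by
      intro a ha
      by_contra! hcon
      obtain ⟨i, hi, -⟩ := h.stack a ha (by simp) (by omega)
      omega
    have hdeg := hlarge v hvm
    have hw := h.stores.nbr_mem (i := 0) (a := v) (by omega)
    set w := h.stores.nbr 0 v with hwdef
    have hweq : s.mem 6 v = w := by simp [hwdef, Stores.nbr]
    have hwl := w.2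
    rw [mem_nbrs] at hw
    refine .seq (.set ?_ (.seq (.set ?_ (.removeEdge (H := H) (a := v) (b := w)
      (h.stores.congr ?_ ?_ ?_ ?_) hW ?_ ?_ ?_ hw fun s₁ hs₁ hr₁ h₉₁ hm₁ => ?_))))
    any_goals simp [nbrE, hv, h.stores.size, hweq]
    any_goals omega
    refine ⟨m - 1, by omega, by omega, Or.inl ⟨_, X, ops, Represents.deleteEdge (s := (s.setReg 6
      ((RamExpr.reg 4).eval s)).setReg 8 ((nbrE (.const 0) (.reg 6)).eval
        (s.setReg 6 ((RamExpr.reg 4).eval s)))) ?_ hs₁ hr₁ h₉₁ hm₁, ?_, ?_, h.nonempty,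
      fun a x hax => h.isolated a x (SimpleGraph.deleteEdges_le _ hax), ?_⟩⟩
    · exact h.toRepresents.congr (by simp) (by simp +contextual)
    · simp [hr₁, h.running]
    · have hE := ncard_edgeSet_deleteEdges hw
      -- The handshake lemma gives at least `(q + 1) * X.verts.card` edges, one more than the
      -- invariant needs because `X` is non-empty.
      have hsum : (2 * q + 2) * X.verts.card ≤ 2 * H.edgeSet.ncard := by
        rw [← sum_card_nbrs, mul_comm, ← smul_eq_mul]
        refine (Finset.card_nsmul_le_sum X.verts _ _ hlarge).trans ?_
        exact Finset.sum_le_sum_of_subset (Finset.subset_univ _)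
      have hpos := Finset.card_pos.2 h.nonempty
      have : (2 * q + 2) * X.verts.card = 2 * (q * X.verts.card) + 2 * X.verts.card := by ring
      omega
    · have hE := ncard_edgeSet_deleteEdges hw
      simp [hr₁, -SimpleGraph.edgeSet_deleteEdges]
      omega

/-- The main loop finds a dense neighbourhood in linear time. -/
theorem exec_mainLoop {n W q M : ℕ} {G : SimpleGraph (Fin n)} {s : RamState}
    {H : SimpleGraph (Fin n)} {X : LabelledGraph (Fin n)} {ops : List (MinorOp (Fin n))}
    (hq : 0 < q) (hW : (n + 2) * (n + 2) ≤ W) (hb : (2 * q + 1) * n + n < W)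
    (hM : M + 4 * q + 9 ≤ W) (h : Progress G q M s H X ops) :
    ∃ k s', RamExec W (mainLoop q) s k s' ∧
      k ≤ M * (4 + (RamProg.ite (.reg 3) (popVertex q) thinOut).time) + 4 ∧
      ∃ H X ops v, Found G q s' H X ops v := by
  obtain ⟨k, s', he, hk, ⟨m', hm', hI⟩, hc⟩ := Run.loop (MainInv G q M)
    (c := .lt (.reg 5) (.const 1)) (p := .ite (.reg 3) (popVertex q) thinOut) (W := W)
    (fun _ s hI => by
      rw [RamExpr.fits_lt (by omega)]
      rcases hI.2 with ⟨H, X, ops, h⟩ | ⟨H, X, ops, v, h⟩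
      · simp [h.running]; omega
      · simp [h.halted]; omega)
    (fun _ s hI hne => by
      rcases hI.2 with ⟨H, X, ops, h⟩ | ⟨H, X, ops, v, h⟩
      · have := h.potential
        have := hI.1
        exact .ite (by simp; omega) (fun h3 => .popVertex hq hW hb hM hI.1 h h3)
          fun h3 => .thinOut hW hM hI.1 h h3
      · simp [h.halted] at hne)
    M s ⟨le_rfl, Or.inl ⟨H, X, ops, h⟩⟩
  refine ⟨k, s', he, hk, ?_⟩
  rcases hI with ⟨H, X, ops, h⟩ | hF
  · simp [h.running] at hc
  · exact hF

/-! ### Dense neighbourhoods -/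

/-- The list of neighbours as an embedding. -/
noncomputable def Stores.nbrEmbedding {n : ℕ} {s : RamState} {H : SimpleGraph (Fin n)} (h : Stores n s (nbrs H))
    (v : Fin n) : Fin (nbrs H v).card ↪ Fin n where
  toFun i := h.nbr i v
  inj' i j hij := Fin.ext (h.nbr_injOn v (by simp) (by simp) hij)

theorem Stores.map_nbrEmbedding {n : ℕ} {s : RamState} {H : SimpleGraph (Fin n)}
    (h : Stores n s (nbrs H)) (v : Fin n) : Finset.univ.map (h.nbrEmbedding v) = nbrs H v := by
  rw [Finset.map_eq_image]
  refine Eq.trans ?_ (h.image_nbr v)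
  ext x
  simp only [Finset.mem_image, Finset.mem_univ, true_and, Finset.mem_range]
  exact ⟨fun ⟨i, hi⟩ => ⟨i, i.2, hi⟩, fun ⟨i, hi, hx⟩ => ⟨⟨i, hi⟩, hx⟩⟩

/-- The common neighbours of `u` and `v` are the neighbours of `u` within the neighbourhood of `v`.
-/
theorem Stores.le_degree_comap {n q : ℕ} {s : RamState} {H : SimpleGraph (Fin n)}
    (h : Stores n s (nbrs H)) {v : Fin n} (hdense : ∀ u, H.Adj v u → q ≤ (commonNbrs H u v).card)
    (i : Fin (nbrs H v).card) : q ≤ ((H.comap (h.nbrEmbedding v)).neighborSet i).ncard := by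
  classical
  refine (hdense (h.nbrEmbedding v i) (mem_nbrs.1 (h.nbr_mem i.2))).trans ?_
  rw [← coe_nbrs, Set.ncard_coe_finset]
  refine (Finset.card_le_card fun x hx => ?_).trans (Finset.card_map (h.nbrEmbedding v)).le
  rw [commonNbrs, Finset.mem_filter] at hx
  obtain ⟨hxv, hx⟩ := hx
  have hxv' : x ∈ Finset.univ.map (h.nbrEmbedding v) := by rwa [h.map_nbrEmbedding]
  obtain ⟨j, -, rfl⟩ := Finset.mem_map.1 hxv'
  exact Finset.mem_map_of_mem _ (mem_nbrs.2 hx)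

theorem Found.denseNeighborhood {n q : ℕ} {G : SimpleGraph (Fin n)} {s : RamState}
    {H : SimpleGraph (Fin n)} {X : LabelledGraph (Fin n)} {ops : List (MinorOp (Fin n))}
    {v : Fin n} (h : Found G q s H X ops v) :
    DenseNeighborhood q X v (H.comap (h.stores.nbrEmbedding v)) (h.stores.nbrEmbedding v) := by
  have hadj : ∀ i, H.Adj v (h.stores.nbrEmbedding v i) := fun i =>
    mem_nbrs.1 (h.stores.nbr_mem i.2)
  exact ⟨h.mem, h.degree_pos, fun i => h.isolated _ _ (hadj i).symm, fun i => h.le (hadj i),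
    fun i j hij => h.le hij, h.stores.le_degree_comap h.dense⟩

/-! ### Reading the input -/

/-- Reading the edge whose number is in register `10`. -/
def readEdge : RamProg :=
  .seq (.set 6 (.load 0 (.reg 10))) (.seq (.set 7 (.load 1 (.reg 10))) (.seq (addEdge 6 7)
    (.set 10 (.reg 10 + .const 1))))

/-- Reading the first `q * n` edges. -/
def readEdges (q : ℕ) : RamProg := .loop (.lt (.reg 10) (.const q * .reg 2)) readEdge

/-- Pushing all vertices on the stack. -/
def pushAll : RamProg := .loop (.lt (.reg 3) (.reg 2)) (push 3)

/-- The initialization. -/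
def setUp (q : ℕ) : RamProg :=
  .seq (.set 2 (.reg 0)) (.seq (.set 0 (.const 0)) (.seq pushAll (readEdges q)))

/-- The state after the first `j` vertices are pushed and the first `i` edges are read. -/
structure Initialized {n : ℕ} (es : List (Fin n × Fin n)) (j i : ℕ) (s : RamState)
    (H : SimpleGraph (Fin n)) : Prop where
  stores : Stores n s (nbrs H)
  adj_iff : ∀ u v, H.Adj u v ↔ s(u, v) ∈ (es.map fun e => s(e.1, e.2)).take i
  edges : H.edgeSet.ncard = i
  reg_zero : s.reg 0 = 0
  reg_three : s.reg 3 = j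
  reg_four : s.reg 4 = 0
  reg_five : s.reg 5 = 0
  reg_ten : s.reg 10 = i
  input_fst : ∀ k (hk : k < es.length), s.mem 0 k = es[k].1
  input_snd : ∀ k (hk : k < es.length), s.mem 1 k = es[k].2
  absent : ∀ k, s.mem 8 k = 0
  stack_lt : ∀ k, s.mem 9 k < n
  stack : ∀ k < j, s.mem 9 k = k

/-- `push 3` pushes the stack height itself, so cell `k` receives the label `k`. With every vertex
on the stack, the stack condition holds for any graph read afterwards. -/
theorem exec_pushAll {n W : ℕ} {es : List (Fin n × Fin n)} {s : RamState} (hn : n + 1 < W)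
    (h : Initialized es 0 0 s ⊥) :
    ∃ k s', RamExec W pushAll s k s' ∧ k ≤ n * (4 + (push 3).time) + 4 ∧
      Initialized es n 0 s' ⊥ := by
  obtain ⟨k, s', he, hk, ⟨m, j, hj, hI⟩, hc⟩ := Run.loop
    (fun m s => ∃ j, j + m = n ∧ Initialized es j 0 s ⊥)
    (c := .lt (.reg 3) (.reg 2)) (p := push 3) (W := W)
    (by
      rintro m s ⟨j, hj, hI⟩
      rw [RamExpr.fits_lt (by omega)]
      simp [hI.reg_three, hI.stores.size]
      omega)
    (by
      rintro m s ⟨j, hj, hI⟩ hne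
      simp [hI.reg_three, hI.stores.size] at hne
      refine .seq (.store ?_ ?_ (.set ?_ ⟨m - 1, by omega, j + 1, by omega,
        hI.stores.congr ?_ ?_ ?_ ?_, hI.adj_iff, hI.edges, ?_, ?_, ?_, ?_, ?_, ?_, ?_, ?_, ?_, ?_⟩))
      any_goals simp [hI.reg_zero, hI.reg_three, hI.reg_four, hI.reg_five, hI.reg_ten]
      any_goals omega
      · exact hI.input_fst
      · exact hI.input_snd
      · exact hI.absent
      · intro k
        split
        · exact hne
        · exact hI.stack_lt k
      · intro k hk
        split
        · omega
        · exact hI.stack k (by omega))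
    n s ⟨0, by omega, h⟩
  refine ⟨k, s', he, hk, ?_⟩
  have : j = n := by
    simp [hI.reg_three, hI.stores.size] at hc
    omega
  rwa [this] at hI

theorem Run.readEdge {n W : ℕ} {G : SimpleGraph (Fin n)} {es : List (Fin n × Fin n)}
    (hes : IsEdgeList G es) {s : RamState} (hW : (n + 2) * (n + 2) ≤ W) {i j : ℕ} (hiW : i + 1 < W)
    (hi : i < es.length) {H : SimpleGraph (Fin n)} (hI : Initialized es j i s H) :
    Run W readEdge s fun s' => ∃ H', Initialized es j (i + 1) s' H' := by
  have ha := hI.input_fst i hi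
  have hb := hI.input_snd i hi
  have hget : (es.map fun e => s(e.1, e.2))[i]'(by simpa using hi) = s(es[i].1, es[i].2) := by simp
  generalize es[i].1 = a at ha hget
  generalize es[i].2 = b at hb hget
  have hal := a.2
  have hbl := b.2
  have hn : n + 2 < W := by nlinarith
  have hab : G.Adj a b := by
    rw [← hes.2, ← hget]; exact List.getElem_mem _
  -- The list has no repeated edge, so no earlier entry equals the current one.
  have hnot : ¬ H.Adj a b := by
    rw [hI.adj_iff, ← hget]
    intro hmem
    obtain ⟨k, hk, hk'⟩ := List.mem_take_iff_getElem.1 hmem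
    have := (List.Nodup.getElem_inj_iff hes.1).1 hk'
    omega
  refine .seq (.set ?_ (.seq (.set ?_ (.seq (.addEdge (H := H) (a := a) (b := b)
    (hI.stores.congr ?_ ?_ ?_ ?_) hW ?_ ?_ hab.ne hnot fun s₁ hs₁ hss => ?_)))))
  any_goals simp [hI.reg_ten, ha, hb]
  any_goals omega
  have hr := congrFun hss.1
  have hm : ∀ k i, k ≠ 5 → k ≠ 6 → k ≠ 7 → s₁.mem k i = s.mem k i := hss.2
  simp only [RamState.reg_setReg] at hr
  refine .set ?_ ⟨_, hs₁.congr ?_ ?_ ?_ ?_, fun u v => ?_, ?_, ?_, ?_, ?_, ?_, ?_, fun k hk => ?_,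
    fun k hk => ?_, fun k => ?_, fun k => ?_, fun k hk => ?_⟩
  any_goals simp [hr, hI.reg_zero, hI.reg_three, hI.reg_four, hI.reg_five, hI.reg_ten,
    -SimpleGraph.edgeSet_sup, hm]
  any_goals omega
  · rw [SimpleGraph.edge_adj, hI.adj_iff, List.take_add_one, List.mem_append,
      List.getElem?_eq_getElem (by simpa using hi), hget]
    have := hab.ne
    simp only [Option.toList_some, List.mem_singleton, Sym2.eq_iff]
    grind
  · rw [ncard_edgeSet_sup_edge hab.ne hnot, hI.edges]
  · exact hI.input_fst k hk
  · exact hI.input_snd k hk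
  · exact hI.absent k
  · exact hI.stack_lt k
  · exact hI.stack k hk

theorem exec_readEdges {n q W : ℕ} {G : SimpleGraph (Fin n)} {es : List (Fin n × Fin n)}
    (hes : IsEdgeList G es) (hlen : q * n ≤ es.length) {s : RamState}
    (hW : (n + 2) * (n + 2) ≤ W) (hq : q < W) (hqn : q * n + 1 < W) {j : ℕ}
    (h : Initialized es j 0 s ⊥) :
    ∃ k s' H, RamExec W (readEdges q) s k s' ∧ k ≤ q * n * (6 + readEdge.time) + 6 ∧
      Initialized es j (q * n) s' H := by
  have h1 : n + 1 < W := by nlinarith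
  obtain ⟨k, s', he, hk, ⟨m, i, hi, H, hI⟩, hc⟩ := Run.loop
    (fun m s => ∃ i, i + m = q * n ∧ ∃ H, Initialized es j i s H)
    (c := .lt (.reg 10) (.const q * .reg 2)) (p := readEdge) (W := W)
    (by
      rintro m s ⟨i, hi, H, hI⟩
      rw [RamExpr.fits_lt (by omega)]
      simp [hI.reg_ten, hI.stores.size]
      omega)
    (by
      rintro m s ⟨i, hi, H, hI⟩ hne
      simp [hI.reg_ten, hI.stores.size] at hne
      exact (Run.readEdge hes hW (by omega) (by omega) hI).mono fun s' hs' =>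
        ⟨m - 1, by omega, i + 1, by omega, hs'⟩)
    (q * n) s ⟨0, by omega, _, h⟩
  refine ⟨k, s', H, he, hk, ?_⟩
  have : i = q * n := by
    simp [hI.reg_ten, hI.stores.size] at hc
    omega
  rwa [this] at hI

/-- The initialization takes linear time. -/
theorem exec_setUp {n q W : ℕ} {G : SimpleGraph (Fin n)} {es : List (Fin n × Fin n)}
    (hn : 0 < n) (hes : IsEdgeList G es) (hlen : q * n ≤ es.length)
    (hW : (n + 2) * (n + 2) ≤ W) (hq : q < W) (hqn : q * n + 1 < W) :
    ∃ k s' H, RamExec W (setUp q) (ramInput n es) k s' ∧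
      k ≤ n * (4 + (push 3).time) + q * n * (6 + readEdge.time) + 14 ∧
      Progress G q (n + 3 * (q * n) + (4 * q + 2) * n + n) s' H ⟨Finset.univ, G⟩ [] := by
  have hn2 : n + 2 < W := by nlinarith
  have hnbrs : ∀ a : Fin n, nbrs (⊥ : SimpleGraph (Fin n)) a = ∅ := fun a => by ext; simp
  -- Zero memory represents the graph without edges; `0 < n` makes the zero cells valid labels.
  have hI : Initialized es 0 0 (((ramInput n es).setReg 2 n).setReg 0 0) ⊥ := by
    refine ⟨⟨?_, ?_, ?_, ?_, ?_, ?_⟩, ?_, ?_, ?_, ?_, ?_, ?_, ?_, ?_, ?_, ?_, ?_, ?_⟩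
    all_goals simp [hnbrs, ramInput, hn]
    all_goals simp +contextual
  obtain ⟨k₁, s₁, he₁, hk₁, hI₁⟩ := exec_pushAll (W := W) (by omega) hI
  obtain ⟨k₂, s₂, H, he₂, hk₂, hI₂⟩ := exec_readEdges hes hlen hW hq hqn hI₁
  refine ⟨_, s₂, H, .seq _ _ _ _ _ _ _ (.set (ramInput n es) 2 (.reg 0) ?_)
    (.seq _ _ _ _ _ _ _ (.set _ 0 (.const 0) ?_) (.seq _ _ _ _ _ _ _ he₁ he₂)), ?_, ?_⟩
  · simp [ramInput]; omega
  · simp; omega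
  · simp only [RamExpr.cost]; omega
  · have hle : H ≤ G := fun u v huv => by
      rw [hI₂.adj_iff] at huv
      exact (hes.2 u v).1 (List.mem_of_mem_take huv)
    refine ⟨⟨hI₂.stores, rfl, ⟨hI₂.reg_zero, by simp⟩, hle, ?_, hI₂.stack_lt, fun a _ _ _ =>
      ⟨a, ?_, hI₂.stack a a.2⟩, ?_, ?_, ?_⟩, hI₂.reg_five, ?_, ⟨⟨0, hn⟩, by simp⟩, by simp, ?_⟩
    all_goals simp [hI₂.reg_zero, hI₂.reg_three, hI₂.reg_four, hI₂.edges, hI₂.absent]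

/-- The search phase of the algorithm: a vertex with a dense neighbourhood of bounded size is found
in linear time. -/
theorem exec_findNeighborhood {q : ℕ} (hq : 0 < q) : ∃ C K : ℕ,
    ∀ {n W : ℕ} {G : SimpleGraph (Fin n)} {es : List (Fin n × Fin n)}, 0 < n → IsEdgeList G es →
      q * n ≤ G.edgeSet.ncard → K * ((n + 2) * (n + 2)) ≤ W →
      ∃ k s, RamExec W (.seq (setUp q) (mainLoop q)) (ramInput n es) k s ∧ k ≤ C * n ∧
        ∃ H X ops v, Found G q s H X ops v := by
  set c := 4 + (RamProg.ite (.reg 3) (popVertex q) thinOut).time with hc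
  refine ⟨4 + (push 3).time + q * (6 + readEdge.time) + 14 + (7 * q + 4) * c + 4, 20 * q + 20,
    fun {n W G es} hn hes hG hW => ?_⟩
  have hlen : q * n ≤ es.length := by rwa [hes.length_eq]
  have hsq : (n + 2) * (n + 2) ≤ W := by nlinarith
  have hqn : q * n + q ≤ q * ((n + 2) * (n + 2)) := by nlinarith [Nat.zero_le (q * (n * n))]
  have hexp : (20 * q + 20) * ((n + 2) * (n + 2)) =
    20 * (q * ((n + 2) * (n + 2))) + 20 * ((n + 2) * (n + 2)) := by ring
  have hn2 : n + 4 ≤ (n + 2) * (n + 2) := by nlinarith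
  have hM : (n + 3 * (q * n) + (4 * q + 2) * n + n) = 7 * (q * n) + 4 * n := by ring
  have hb : (2 * q + 1) * n + n = 2 * (q * n) + 2 * n := by ring
  obtain ⟨k₁, s₁, H, he₁, hk₁, hP⟩ := exec_setUp hn hes hlen hsq (by omega) (by omega)
  obtain ⟨k₂, s₂, he₂, hk₂, hF⟩ := exec_mainLoop hq hsq (by omega) (by omega) hP
  refine ⟨_, s₂, .seq _ _ _ _ _ _ _ he₁ he₂, ?_, hF⟩
  rw [← hc, hM] at hk₂
  calc k₁ + k₂ ≤ n * (4 + (push 3).time) + q * n * (6 + readEdge.time) + 14 +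
        ((7 * (q * n) + 4 * n) * c + 4) := Nat.add_le_add hk₁ hk₂
    _ ≤ n * (4 + (push 3).time) + q * n * (6 + readEdge.time) + 14 * n +
        ((7 * (q * n) + 4 * n) * c + 4 * n) := by omega
    _ = _ := by ring

/-! ### The extremal function -/

/-- Large average degree forces a `K_t`-minor. -/
theorem exists_edges_force_cliqueMinor (t : ℕ) : ∃ q : ℕ, 0 < q ∧
    ∀ (n : ℕ) (G : SimpleGraph (Fin n)), 0 < n → q * n ≤ G.edgeSet.ncard → HasCliqueMinor G t := by
  induction t with
  | zero => exact ⟨1, one_pos, fun n G _ _ => hasCliqueMinor_zero G⟩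
  | succ t ih =>
    obtain ⟨q, hq, h⟩ := ih
    -- Minimum degree `2 * q` in the neighbourhood gives `q` edges per vertex there, as the
    -- induction hypothesis demands.
    refine ⟨2 * q, by omega, fun n G hn hG => ?_⟩
    obtain ⟨es, hes⟩ := exists_isEdgeList G
    obtain ⟨C, K, hrun⟩ := exec_findNeighborhood (q := 2 * q) (by omega)
    -- The run is used as an existence proof, with the word size as small as `exec_findNeighborhood`
    -- permits; the execution and its time are discarded.
    obtain ⟨k, s, -, -, H, X, ops, v, hF⟩ := hrun hn hes hG le_rfl
    have hD := hF.denseNeighborhood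
    refine hD.hasCliqueMinor hF.reaches (h _ _ hD.pos ?_)
    have := mul_le_two_mul_edges hD.le_degree
    have : 2 * q * (nbrs H v).card = 2 * (q * (nbrs H v).card) := by ring
    omega

/-- The average degrees that force a `K_t`-minor. -/
def forcingDegrees (t : ℕ) : Set ℝ :=
  {D : ℝ | ∀ (n : ℕ) (G : SimpleGraph (Fin n)), 0 < n → D ≤ avgDegree G → HasCliqueMinor G t}

/-- Without this, `minorThreshold` could be the default value 0 of an infimum over the empty set. -/
theorem forcingDegrees_nonempty (t : ℕ) : (forcingDegrees t).Nonempty := by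
  obtain ⟨q, -, h⟩ := exists_edges_force_cliqueMinor t
  refine ⟨2 * q, fun n G hn hG => h n G hn ?_⟩
  rw [avgDegree, le_div_iff₀ (by positivity)] at hG
  have : (q : ℝ) * n ≤ G.edgeSet.ncard := by linarith
  exact_mod_cast this

/-- Makes g unbounded, so that rounding to an integer `q` is absorbed by ε. -/
theorem le_minorThreshold (t : ℕ) : (t : ℝ) ≤ minorThreshold (t + 2) :=
  le_csInf (forcingDegrees_nonempty _) fun _ hD => (lt_of_forces_cliqueMinor hD).le

/-- Average degree above the threshold forces a `K_t`-minor. -/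
theorem hasCliqueMinor_of_minorThreshold_lt {t n : ℕ} (hn : 0 < n) {G : SimpleGraph (Fin n)}
    (h : minorThreshold t < avgDegree G) : HasCliqueMinor G t := by
  obtain ⟨D, hD, hlt⟩ := exists_lt_of_csInf_lt (forcingDegrees_nonempty t) h
  exact hD n G hn hlt.le

/-! ### The final phase -/

/-- Deleting the vertex in register `10`, if present, unless it is a neighbour of the vertex in
register `6`. -/
def restrictStep : RamProg :=
  .seq (.ite (.lt (.load 8 (.reg 10)) (.const 1) * .eq (posE (.reg 6) (.reg 10)) (.const 0))
      (.seq (emit 0 (.reg 10) (.const 0)) (.store 8 (.reg 10) (.const 1))) .skip)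
    (.set 10 (.reg 10 + .const 1))

/-- Deleting all vertices but the neighbours of the vertex in register `6`. -/
def restrict : RamProg :=
  .seq (.set 10 (.const 0)) (.loop (.lt (.reg 10) (.reg 2)) restrictStep)

/-- All vertices below `i` but the neighbours of `v` have been deleted. -/
structure Restricting {n : ℕ} (G : SimpleGraph (Fin n)) (b i : ℕ) (v : Fin n) (s : RamState)
    (H : SimpleGraph (Fin n)) (X : LabelledGraph (Fin n)) (ops : List (MinorOp (Fin n))) : Prop
    extends Represents G b {v} s H X ops where
  center : s.reg 6 = v
  counter : s.reg 10 = i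
  nbrs_subset : nbrs H v ⊆ X.verts
  deleted : ∀ a ∈ X.verts, (a : ℕ) < i → a ∈ nbrs H v

theorem Represents.counter {n b : ℕ} {G : SimpleGraph (Fin n)} {T : Set (Fin n)}
    {s : RamState} {H : SimpleGraph (Fin n)} {X : LabelledGraph (Fin n)}
    {ops : List (MinorOp (Fin n))} (h : Represents G b T s H X ops) (x : ℕ) :
    Represents G b T (s.setReg 10 x) H X ops where
  stores := h.stores.congr (by simp) (by simp) (by simp) (by simp)
  reaches := h.reaches
  outputs := h.outputs.congr (by simp) (by simp) (by simp) (by simp)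
  le := h.le
  absent := h.absent
  stack_lt := h.stack_lt
  stack := by simpa using h.stack
  first := by simpa using h.first
  first_le := by simpa using h.first_le
  output_le := by simpa using h.output_le

theorem Run.restrictStep {n W b i : ℕ} {G : SimpleGraph (Fin n)} {s : RamState}
    {H : SimpleGraph (Fin n)} {X : LabelledGraph (Fin n)} {ops : List (MinorOp (Fin n))}
    {v : Fin n} (hW : (n + 2) * (n + 2) ≤ W) (hi : i < n)
    (h : Restricting G b i v s H X ops) :
    Run W restrictStep s fun s' => ∃ X' ops', Restricting G b (i + 1) v s' H X' ops' := by
  obtain ⟨a, rfl⟩ : ∃ a : Fin n, i = a := ⟨⟨i, hi⟩, rfl⟩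
  have hv := h.center
  have ha := h.counter
  have hvl := v.2
  have hn : n + 2 < W := by nlinarith
  have h1 : 1 < W := by omega
  have hadr := mul_add_lt_of_sq_le hW v.2.le a.2.le
  have hpos := h.stores.pos_le v a
  have hout := h.output_le
  have hiff := h.stores.pos_ne_zero_iff (a := v) (b := a)
  refine .seq (.ite ?_ (fun hne => ?_) fun h0 => ?_)
  · simp only [posE, RamExpr.fits_mul, RamExpr.fits_lt h1, RamExpr.fits_eq h1, RamExpr.fits_load,
      RamExpr.fits_add, RamExpr.fits_reg, RamExpr.fits_const, RamExpr.eval_reg, RamExpr.eval_lt,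
      RamExpr.eval_load, RamExpr.eval_add, RamExpr.eval_mul, RamExpr.eval_eq, RamExpr.eval_const,
      hv, ha, h.stores.size, h.absent]
    refine ⟨⟨⟨by omega, by split <;> omega⟩, by omega⟩, ⟨⟨⟨⟨by omega, by omega, by omega⟩,
      by omega, hadr⟩, by omega⟩, by omega⟩, by split_ifs <;> omega⟩
  · simp only [posE, RamExpr.eval_reg, RamExpr.eval_lt,
      RamExpr.eval_load, RamExpr.eval_add, RamExpr.eval_mul, RamExpr.eval_eq, RamExpr.eval_const,
      hv, ha, h.stores.size, h.absent] at hne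
    have ham : a ∈ X.verts := by by_contra hcon; simp [hcon] at hne
    have hav : a ∉ nbrs H v := by
      rw [← hiff]
      by_contra hcon
      simp [hcon] at hne
    have hcard : 0 < X.verts.card := Finset.card_pos.2 ⟨a, ham⟩
    refine .seq (.emit (x := a) (y := 0) (op := .deleteVertex a) h.outputs ?_ ?_
      (fun s' hr _ => ?_) (fun s' hr _ => ?_) ?_ fun s₁ hout₁ hs₁ => .store ?_ ?_ ?_)
    any_goals simp [MinorOp.EncodedBy]
    any_goals omega
    · simp [hr, ha]; omega
    · simp [hs₁.1, ha]; omega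
    have ha₁ : s₁.reg 10 = a := by simp [hs₁.1, ha]
    have hstep := h.toRepresents.step (T' := {v}) (op := .deleteVertex a) ham ham rfl h.le
      (by simp) hout₁ hs₁ (s'' := s₁.setMem 8 (s₁.reg 10) 1) (by rw [ha₁])
    refine .set (by simp [ha₁]; omega) ⟨_, _, hstep.counter _, ?_, ?_, ?_, ?_⟩
    · simp [hs₁.1, hv]
    · simp [ha₁]
    · intro x hx
      refine Finset.mem_erase.2 ⟨?_, h.nbrs_subset hx⟩
      rintro rfl
      exact hav hx
    · intro x hx hxa
      obtain ⟨hne, hx⟩ := Finset.mem_erase.1 hx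
      have := Fin.val_ne_of_ne hne
      exact h.deleted x hx (by omega)
  · simp only [posE, RamExpr.eval_reg, RamExpr.eval_lt,
      RamExpr.eval_load, RamExpr.eval_add, RamExpr.eval_mul, RamExpr.eval_eq, RamExpr.eval_const,
      hv, ha, h.stores.size, h.absent] at h0
    refine .skip (.set (by simp [ha]; omega) ⟨X, ops, h.toRepresents.counter _, by simp [hv],
      by simp [ha], h.nbrs_subset, fun x hx hxa => ?_⟩)
    by_cases hxa' : (x : ℕ) < a
    · exact h.deleted x hx hxa'
    · obtain rfl : x = a := Fin.ext (by omega)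
      rw [← hiff]
      intro hcon
      simp [hx, hcon] at h0

/-- The centre `v` goes as well, not being its own neighbour: the K_t-minor comes from the
neighbourhood alone. -/
theorem exec_restrict {n W q : ℕ} {G : SimpleGraph (Fin n)} {s : RamState}
    {H : SimpleGraph (Fin n)} {X : LabelledGraph (Fin n)} {ops : List (MinorOp (Fin n))}
    {v : Fin n} (hW : (n + 2) * (n + 2) ≤ W) (h : Found G q s H X ops v) :
    ∃ k s', RamExec W restrict s k s' ∧ k ≤ n * (4 + restrictStep.time) + 6 ∧
      ∃ X ops, Represents G (2 * q + 1) {v} s' H X ops ∧ s'.reg 6 = v ∧ X.verts = nbrs H v := by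
  have hn : n + 2 < W := by nlinarith [v.pos]
  have hstart : Restricting G (2 * q + 1) 0 v (s.setReg 10 0) H X ops :=
    ⟨h.toRepresents.counter 0, by simp [h.center], by simp,
      fun u hu => h.isolated u v (mem_nbrs.1 hu).symm, by simp⟩
  obtain ⟨k, s', he, hk, ⟨m, i, hi, X', ops', hI⟩, hc⟩ := Run.loop
    (fun m s => ∃ i, i + m = n ∧ ∃ X ops, Restricting G (2 * q + 1) i v s H X ops)
    (c := .lt (.reg 10) (.reg 2)) (p := restrictStep) (W := W)
    (by
      rintro m s ⟨i, hi, X, ops, hI⟩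
      rw [RamExpr.fits_lt (by omega)]
      simp [hI.counter, hI.stores.size]
      omega)
    (by
      rintro m s ⟨i, hi, X, ops, hI⟩ hne
      simp [hI.counter, hI.stores.size] at hne
      exact (Run.restrictStep hW hne hI).mono fun s' hs' =>
        ⟨m - 1, by omega, i + 1, by omega, hs'⟩)
    n (s.setReg 10 0) ⟨0, by omega, X, ops, hstart⟩
  refine ⟨_, s', .seq _ _ _ _ _ _ _ (.set s 10 (.const 0) ?_) he, ?_, X', ops', hI.toRepresents,
    hI.center, ?_⟩
  · simp; omega
  · have : k ≤ n * (4 + restrictStep.time) + 4 := hk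
    simp only [RamExpr.cost]; omega
  · refine Finset.Subset.antisymm (fun a ha => hI.deleted a ha ?_) hI.nbrs_subset
    simp [hI.counter, hI.stores.size] at hc
    have := a.2
    omega

/-! ### Lookup in a table of small graphs -/

/-- The output of an operation on the neighbourhood of the vertex in register `6`, where vertices
are given by their positions in the list of neighbours. -/
def emitOp {d : ℕ} : MinorOp (Fin d) → RamProg
  | .deleteVertex i => emit 0 (nbrE (.const i) (.reg 6)) (.const 0)
  | .deleteEdge i j => emit 1 (nbrE (.const i) (.reg 6)) (nbrE (.const j) (.reg 6))
  | .contract i j => emit 2 (nbrE (.const i) (.reg 6)) (nbrE (.const j) (.reg 6))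

/-- The output of several operations. -/
def emitOps {d : ℕ} : List (MinorOp (Fin d)) → RamProg
  | [] => .skip
  | op :: ops => .seq (emitOp op) (emitOps ops)

theorem Run.emitOp {n W b d : ℕ} {s : RamState} {H : SimpleGraph (Fin n)} {v : Fin n}
    (h : Stores n s (nbrs H)) (hW : (n + 2) * (n + 2) ≤ W) (hb : b * n + n < W) (hd : d ≤ b)
    (hv : s.reg 6 = v) {φ : Fin d → Fin n} (hφ : ∀ i : Fin d, s.mem 6 (i * n + v) = φ i)
    {ops : List (MinorOp (Fin n))} (hout : s.Outputs ops) (h₀ : s.reg 0 + 1 < W)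
    (op : MinorOp (Fin d)) {Q : RamState → Prop}
    (hQ : ∀ s', s'.Outputs (ops ++ [op.map φ]) → OnlyOutput s s' → Q s') :
    Run W (emitOp op) s Q := by
  have hvl := v.2
  have hn : n + 2 < W := by nlinarith
  have hnbr : ∀ (i : Fin d) (s' : RamState), (∀ r, s'.reg r = s.reg r) →
      (∀ k i, k ≠ 2 → k ≠ 3 → k ≠ 4 → s'.mem k i = s.mem k i) →
      (nbrE (.const i) (.reg 6)).Fits W s' ∧ (nbrE (.const i) (.reg 6)).eval s' = φ i := by
    intro i s' hr hm
    have h' : Stores n s' (nbrs H) := h.congr (hr 2) (fun i => hm _ _ (by decide) (by decide)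
      (by decide)) (fun i => hm _ _ (by decide) (by decide) (by decide))
      (fun i => hm _ _ (by decide) (by decide) (by decide))
    obtain ⟨f, e⟩ := fits_nbrE h' hW hb ((hr 6).trans hv) (i.2.trans_le hd)
    refine ⟨f, e.trans ?_⟩
    rw [← hφ, ← hm 6 _ (by decide) (by decide) (by decide)]
    rfl
  cases op with
  | deleteVertex i =>
    exact .emit (op := .deleteVertex (φ i)) hout h₀ (by omega) (hnbr i)
      (fun s' _ _ => ⟨by simp; omega, rfl⟩) ⟨rfl, rfl⟩ hQ
  | deleteEdge i j =>
    exact .emit (op := .deleteEdge (φ i) (φ j)) hout h₀ (by omega) (hnbr i) (hnbr j)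
      ⟨rfl, rfl, rfl⟩ hQ
  | contract i j =>
    exact .emit (op := .contract (φ i) (φ j)) hout h₀ (by omega) (hnbr i) (hnbr j)
      ⟨rfl, rfl, rfl⟩ hQ

theorem Run.emitOps {n W b d : ℕ} {H : SimpleGraph (Fin n)} {v : Fin n}
    (hW : (n + 2) * (n + 2) ≤ W) (hb : b * n + n < W) (hd : d ≤ b) {φ : Fin d → Fin n}
    (ops' : List (MinorOp (Fin d))) : ∀ {s : RamState} {ops : List (MinorOp (Fin n))},
    Stores n s (nbrs H) → s.reg 6 = v → (∀ i : Fin d, s.mem 6 (i * n + v) = φ i) →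
      s.Outputs ops → s.reg 0 + ops'.length < W →
      Run W (emitOps ops') s fun s' => s'.Outputs (ops ++ ops'.map (MinorOp.map φ)) := by
  induction ops' with
  | nil => intro s ops _ _ _ hout _; exact .skip (by simpa using hout)
  | cons op ops' ih =>
    intro s ops h hv hφ hout h₀
    rw [List.length_cons] at h₀
    refine .seq (.emitOp h hW hb hd hv hφ hout (by omega) op fun s' hout' hs' => ?_)
    have := ih (h.of_onlyOutput hs') (by simp [hs'.1, hv])
      (fun i => by rw [hs'.2 _ _ (by decide) (by decide) (by decide), hφ]) hout'
      (by rw [hs'.1, if_pos rfl]; omega)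
    simpa using this

/-- Operations that turn `A` into a clique on `t` vertices, if there are any. -/
noncomputable def cliqueOps (t : ℕ) {d : ℕ} (A : SimpleGraph (Fin d)) : List (MinorOp (Fin d)) := by
  classical exact if h : HasCliqueMinor A t then h.choose else []

theorem isCliqueMinorOf_cliqueOps {t d : ℕ} {A : SimpleGraph (Fin d)} (h : HasCliqueMinor A t) :
    IsCliqueMinorOf A t (cliqueOps t A) := by
  rw [cliqueOps, dif_pos h]
  exact h.choose_spec

/-- Whether the `i`-th and the `j`-th neighbour of the vertex in register `6` are adjacent precisely
if `c = 1`. -/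
def adjE (i j c : ℕ) : RamExpr :=
  .eq (.lt (.const 0) (posE (nbrE (.const i) (.reg 6)) (nbrE (.const j) (.reg 6)))) (.const c)

/-- Whether the list of neighbours of the vertex in register `6` spans the graph `A`. -/
noncomputable def spansE {d : ℕ} (A : SimpleGraph (Fin d)) : RamExpr := by
  classical
  exact .eq (degE (.reg 6)) (.const d) * .prod ((Finset.univ : Finset (Fin d × Fin d)).toList.map fun e =>
      adjE e.1 e.2 (if A.Adj e.1 e.2 then 1 else 0))

theorem fits_spansE {n W b d : ℕ} {s : RamState} {H : SimpleGraph (Fin n)} {v : Fin n}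
    (h : Stores n s (nbrs H)) (hW : (n + 2) * (n + 2) ≤ W) (hb : b * n + n < W) (hd : d ≤ b)
    (hv : s.reg 6 = v) (A : SimpleGraph (Fin d)) : (spansE A).Fits W s := by
  have hvl := v.2
  have hn : n + 2 < W := by nlinarith
  have hbn : b ≤ b * n := Nat.le_mul_of_pos_right _ v.pos
  have h1 : 1 < W := by omega
  have hdeg := h.deg v
  have hcard := h.card_le v
  classical
  have hprod := RamExpr.fits_prod (s := s) h1
    (l := (Finset.univ : Finset (Fin d × Fin d)).toList.map fun e =>
      adjE e.1 e.2 (if A.Adj e.1 e.2 then 1 else 0)) (by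
    intro e he
    obtain ⟨⟨i, j⟩, -, rfl⟩ := List.mem_map.1 he
    obtain ⟨f₁, e₁⟩ := fits_nbrE h hW hb hv (i.2.trans_le hd)
    obtain ⟨f₂, e₂⟩ := fits_nbrE h hW hb hv (j.2.trans_le hd)
    have hl₁ := (h.nbr i v).2
    have hl₂ := (h.nbr j v).2
    have hp := h.pos_le (h.nbr i v) (h.nbr j v)
    have ha := mul_add_lt_of_sq_le hW hl₁.le hl₂.le
    simp only [adjE, posE, RamExpr.fits_mul, RamExpr.fits_lt h1, RamExpr.fits_eq h1,
      RamExpr.fits_load, RamExpr.fits_add, RamExpr.fits_const, RamExpr.fits_reg, RamExpr.eval_mul,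
      RamExpr.eval_add, RamExpr.eval_reg, RamExpr.eval_eq, e₁, e₂, h.size, f₁, f₂]
    refine ⟨⟨⟨by omega, ⟨⟨trivial, by omega, by omega⟩, trivial, ha⟩, by omega⟩, ?_⟩, ?_⟩
    · split_ifs <;> omega
    · split_ifs <;> simp)
  have hmul : (RamExpr.eq (degE (.reg 6)) (.const d)).eval s * (RamExpr.prod
      ((Finset.univ : Finset (Fin d × Fin d)).toList.map fun e =>
        adjE e.1 e.2 (if A.Adj e.1 e.2 then 1 else 0))).eval s ≤ 1 * 1 :=
    Nat.mul_le_mul (by rw [RamExpr.eval_eq]; split_ifs <;> simp) hprod.2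
  refine ⟨?_, hprod.1, hmul.trans_lt h1⟩
  rw [RamExpr.fits_eq h1]
  simp [degE, hv, hdeg]
  omega

/-- The comparison is position by position. The table contains every labelled graph, so no
isomorphism has to be found. -/
theorem eval_spansE_ne_zero_iff {n W b d : ℕ} {s : RamState} {H : SimpleGraph (Fin n)} {v : Fin n}
    (h : Stores n s (nbrs H)) (hW : (n + 2) * (n + 2) ≤ W) (hb : b * n + n < W) (hd : d ≤ b)
    (hv : s.reg 6 = v) (A : SimpleGraph (Fin d)) : (spansE A).eval s ≠ 0 ↔
      (nbrs H v).card = d ∧ ∀ i j : Fin d, A.Adj i j ↔ H.Adj (h.nbr i v) (h.nbr j v) := by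
  classical
  have hadj : ∀ i j : Fin d, (adjE i j (if A.Adj i j then 1 else 0)).eval s ≠ 0 ↔
      (A.Adj i j ↔ H.Adj (h.nbr i v) (h.nbr j v)) := by
    intro i j
    obtain ⟨f₁, e₁⟩ := fits_nbrE h hW hb hv (i.2.trans_le hd)
    obtain ⟨f₂, e₂⟩ := fits_nbrE h hW hb hv (j.2.trans_le hd)
    have := h.pos_ne_zero_iff (a := h.nbr i v) (b := h.nbr j v)
    rw [mem_nbrs] at this
    simp only [adjE, posE, RamExpr.eval_mul, RamExpr.eval_lt, RamExpr.eval_eq, RamExpr.eval_const,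
      RamExpr.eval_load, RamExpr.eval_add, RamExpr.eval_reg, e₁, e₂, h.size,
      Nat.pos_iff_ne_zero, this]
    by_cases h₁ : A.Adj i j <;> by_cases h₂ : H.Adj (h.nbr i v) (h.nbr j v) <;> simp [h₁, h₂]
  rw [spansE, RamExpr.eval_mul, mul_ne_zero_iff, RamExpr.eval_prod_ne_zero]
  refine and_congr ?_ ?_
  · simp [degE, hv, h.deg]
  · simp only [List.mem_map, Finset.mem_toList, Finset.mem_univ, true_and, Prod.exists,
      forall_exists_index, ← hadj]
    exact ⟨fun hall i j => hall _ i j rfl, fun hall e i j he => he ▸ hall i j⟩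

/-- The graphs on at most `b` vertices. -/
noncomputable def smallGraphs (b : ℕ) : List (Σ d : Fin (b + 1), SimpleGraph (Fin d)) :=
  (Set.toFinite Set.univ).toFinset.toList

/-- Finding a clique minor in the neighbourhood of the vertex in register `6` from a table of all
graphs on at most `b` vertices. -/
noncomputable def lookUp (t b : ℕ) : RamProg :=
  .switch ((smallGraphs b).map fun A => (spansE A.2, emitOps (cliqueOps t A.2)))

/-- A successful test identifies the table entry with the graph that `nbrEmbedding` pulls back, and
some test succeeds because the table is complete. -/
theorem Run.lookUp {n W b t K : ℕ} {s : RamState} {H : SimpleGraph (Fin n)} {v : Fin n}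
    (h : Stores n s (nbrs H)) (hW : (n + 2) * (n + 2) ≤ W) (hb : b * n + n < W)
    (hv : s.reg 6 = v) (hvb : (nbrs H v).card ≤ b)
    (hK : ∀ A ∈ smallGraphs b, (cliqueOps t A.2).length ≤ K) (h₀ : s.reg 0 + K < W)
    {ops : List (MinorOp (Fin n))} (hout : s.Outputs ops) :
    Run W (lookUp t b) s fun s' => s'.Outputs (ops ++
      (cliqueOps t (H.comap (h.nbrEmbedding v))).map (MinorOp.map (h.nbrEmbedding v))) := by
  have hall : ∀ A : (Σ d : Fin (b + 1), SimpleGraph (Fin d)), A ∈ smallGraphs b := by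
    intro A; simp [smallGraphs]
  refine Run.switch ?_ ?_ ?_
  · simp only [List.mem_map]
    rintro _ ⟨A, -, rfl⟩
    exact fits_spansE h hW hb (by omega) hv A.2
  · simp only [List.mem_map]
    rintro _ ⟨⟨⟨d, hd⟩, A⟩, hA, rfl⟩ hne
    obtain ⟨rfl, hadj⟩ := (eval_spansE_ne_zero_iff h hW hb (by simpa using by omega) hv A).1 hne
    obtain rfl : A = H.comap (h.nbrEmbedding v) := by
      ext i j
      exact hadj i j
    have := hK _ hA
    exact .emitOps hW hb hvb _ h hv (fun i => rfl) hout 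
      ((Nat.add_le_add_left this _).trans_lt h₀)
  · refine ⟨_, List.mem_map_of_mem (hall ⟨⟨(nbrs H v).card, by omega⟩,
      H.comap (h.nbrEmbedding v)⟩), ?_⟩
    exact (eval_spansE_ne_zero_iff h hW hb (by simpa using hvb) hv _).2 ⟨rfl, fun i j => Iff.rfl⟩

/-- If every graph of minimum degree at least `q` contains a `K_t`-minor, then a `K_t`-minor in a
graph with at least `q * n` edges is found in linear time. -/
theorem exists_program {t q : ℕ} (hq : 0 < q)
    (hforce : ∀ (d : ℕ) (A : SimpleGraph (Fin d)), 0 < d → (∀ i, q ≤ (A.neighborSet i).ncard) →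
      HasCliqueMinor A t) :
    ∃ (p : RamProg) (C w : ℕ), ∀ (n : ℕ) (G : SimpleGraph (Fin n)), 0 < n →
      q * n ≤ G.edgeSet.ncard → FindsCliqueMinor p t (n ^ w) (C * n) G := by
  obtain ⟨C, K, hfind⟩ := exec_findNeighborhood hq
  set L := ((smallGraphs (2 * q + 1)).map fun A => (cliqueOps t A.2).length).sum with hL
  have hLle : ∀ A ∈ smallGraphs (2 * q + 1), (cliqueOps t A.2).length ≤ L := fun A hA =>
    List.le_sum_of_mem (List.mem_map_of_mem (f := fun A => (cliqueOps t A.2).length) hA)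
  refine ⟨.seq (.seq (setUp q) (mainLoop q)) (.seq restrict (lookUp t (2 * q + 1))),
    C + (4 + restrictStep.time) + 6 + (lookUp t (2 * q + 1)).time, K + 2 * q + 3 + L + 4,
    fun n G hn hG es hes => ?_⟩
  -- One vertex carries no edge. For `n = 1` every power of `n` would be 1, and no word size could
  -- be reached.
  have hn2 : 2 ≤ n := by
    by_contra! hlt
    obtain rfl : n = 1 := by omega
    have : G.edgeSet = ∅ := by
      rw [SimpleGraph.edgeSet_eq_empty]
      exact Subsingleton.elim _ _
    rw [this, Set.ncard_empty] at hG
    omega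
  set W := n ^ (K + 2 * q + 3 + L + 4) with hWdef
  -- The constant factor is below `2 ^ (K + 2 * q + 3 + L)`, and four more powers of `n` cover `(n +
  -- 2) * (n + 2)`. The summands serve the search phase, the addresses in neighbour lists and the
  -- length of the output.
  have hbig : (K + 2 * q + 3 + L) * ((n + 2) * (n + 2)) ≤ W := by
    rw [hWdef, pow_add]
    refine Nat.mul_le_mul ((Nat.lt_two_pow_self).le.trans (Nat.pow_le_pow_left hn2 _)) ?_
    have h4 : n + 2 ≤ n ^ 2 := by nlinarith
    calc (n + 2) * (n + 2) ≤ n ^ 2 * n ^ 2 := Nat.mul_le_mul h4 h4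
      _ = n ^ 4 := by ring
  have hsplit : (K + 2 * q + 3 + L) * ((n + 2) * (n + 2)) = K * ((n + 2) * (n + 2)) +
      (2 * q + 1) * ((n + 2) * (n + 2)) + 2 * ((n + 2) * (n + 2)) + L * ((n + 2) * (n + 2)) := by
    ring
  have hsq : n + 4 ≤ (n + 2) * (n + 2) := by nlinarith
  have hb : (2 * q + 1) * n ≤ (2 * q + 1) * ((n + 2) * (n + 2)) :=
    Nat.mul_le_mul_left _ (by omega)
  have hLn : L ≤ L * ((n + 2) * (n + 2)) := Nat.le_mul_of_pos_right _ (by positivity)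
  obtain ⟨k₁, s₁, he₁, hk₁, H, X, ops, v, hF⟩ := hfind (W := W) hn hes hG (by omega)
  have hW : (n + 2) * (n + 2) ≤ W := by omega
  obtain ⟨k₂, s₂, he₂, hk₂, X', ops', hR, hv, hverts⟩ := exec_restrict hW hF
  have hout := hR.output_le
  obtain ⟨k₃, s₃, he₃, hk₃, hO⟩ := Run.lookUp (t := t) hR.stores hW (by omega) hv hF.degree_le
    hLle (by omega) hR.outputs
  refine ⟨_, s₃, _, .seq _ _ _ _ _ _ _ he₁ (.seq _ _ _ _ _ _ _ he₂ he₃), ?_, hO, ?_⟩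
  · calc k₁ + (k₂ + k₃) ≤ C * n + (n * (4 + restrictStep.time) + 6 +
          (lookUp t (2 * q + 1)).time) := by omega
      _ ≤ C * n + (n * (4 + restrictStep.time) + 6 * n + (lookUp t (2 * q + 1)).time * n) := by
        have := Nat.le_mul_of_pos_right (lookUp t (2 * q + 1)).time hn
        omega
      _ = _ := by ring
  · have hA : HasCliqueMinor (H.comap (hR.stores.nbrEmbedding v)) t :=
      hforce _ _ hF.degree_pos (hR.stores.le_degree_comap hF.dense)
    -- Here `R` is empty: the remaining vertices of `X'` are exactly the copy, and edges of `X'`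
    -- outside `H` are allowed.
    have := (isCliqueMinorOf_cliqueOps hA).map (hR.stores.nbrEmbedding v) ∅ (by simp)
      (Y := X') (by rw [hverts, Finset.union_empty]; exact (hR.stores.map_nbrEmbedding v).symm)
      (fun a _ b _ hab => hR.le hab) (by simp) (by simp)
    exact hR.reaches.producesClique this

theorem theorem1 (ε : ℝ) (hε : 0 < ε) :
    ∃ t₀ : ℕ, ∀ t : ℕ, t₀ ≤ t →
      ∃ (p : RamProg) (C w : ℕ), ∀ (n : ℕ) (G : SimpleGraph (Fin n)),
        (2 + ε) * minorThreshold t ≤ avgDegree G → FindsCliqueMinor p t (n ^ w) (C * n) G := by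
  -- Since g(t) ≥ t - 2, this gives g ≥ 2/ε + 1, hence εg ≥ 2.
  refine ⟨⌈2 / ε⌉₊ + 3, fun t ht => ?_⟩
  set g := minorThreshold t with hg
  have hgt : 2 / ε + 1 ≤ g := by
    obtain ⟨r, rfl⟩ : ∃ r, t = r + 2 := ⟨t - 2, by omega⟩
    refine le_trans ?_ (le_minorThreshold r)
    have h₁ : ⌈2 / ε⌉₊ + 1 ≤ r := by omega
    have h₂ : ((⌈2 / ε⌉₊ + 1 : ℕ) : ℝ) ≤ r := by exact_mod_cast h₁
    push_cast at h₂
    linarith [Nat.le_ceil (2 / ε)]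
  have hgpos : 0 < g := by have : 0 < 2 / ε := by positivity
                           linarith
  have hεg : 2 ≤ ε * g := by
    have : ε * (2 / ε) = 2 := by field_simp
    nlinarith
  -- Strictly above g, so that it does not matter whether the infimum is attained, and at most g +
  -- 1.
  set q := ⌊g⌋₊ + 1 with hq
  have hgq : g < q := by rw [hq]; push_cast; exact Nat.lt_floor_add_one g
  have hqg : (q : ℝ) ≤ g + 1 := by rw [hq]; push_cast; linarith [Nat.floor_le hgpos.le]
  obtain ⟨p, C, w, hp⟩ := exists_program (t := t) (q := q) (by omega) fun d A hd hA =>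
    hasCliqueMinor_of_minorThreshold_lt hd (hgq.trans_le (le_avgDegree hd hA))
  refine ⟨p, C, w, fun n G hG => ?_⟩
  -- For `n = 0` division by zero makes the average degree 0, below the positive bound.
  have hn : 0 < n := by
    by_contra! hn
    obtain rfl : n = 0 := by omega
    simp only [avgDegree, Nat.cast_zero, div_zero] at hG
    nlinarith
  refine hp n G hn ?_
  rw [avgDegree, le_div_iff₀ (by positivity)] at hG
  have hn' : (0 : ℝ) < n := by positivity
  -- Half of (2 + ε)g is at least g + 1, which is at least q.
  have : (q : ℝ) * n ≤ G.edgeSet.ncard := by nlinarith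
  exact_mod_cast this
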